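/- Let $A_0,A_1\in\mathbb R^{n\times n}$ and $0\le\mu\le h$. Consider the system $\dot x(t)=A_0x(t)+A_1x(t-\tau(t))$, $x(t)\in\mathbb R^n$, with delay $\tau(t)=h+\eta(t)$, $|\eta(t)|\le\mu$ for all $t\ge 0$. Put $$\mathcal F(p)=\frac{2p+1}{p+1}\ (0\le p<1),\qquad \mathcal F(p)=\frac{7p-1}{4p}\ (1\le p<\infty),\qquad \mathcal F(\infty)=\frac74 .$$ For a value $F>0$ consider the following linear matrix inequality $\mathrm{LMI}(F)$ in the real $n\times n$ matrices $P_1>0$, $P_2$, $P_3$, $S>0$, $Y_1$, $Y_2$, $T$, $R$, $R_a$ (where $M>0$ means that $M$ is symmetric and positive definite, $M<0$ means $-M>0$, and $*$ denotes blocks determined by symmetry): $$\begin{bmatrix}\Psi & P^T\begin{bmatrix}0\\A_1\end{bmatrix}-Y^T+\begin{bmatrix}T\\0\end{bmatrix} & hY^T & \begin{bmatrix}\mu P_2^TA_1\\ \mu P_3^TA_1\end{bmatrix} & \begin{bmatrix}0\\ \mu F R_a\end{bmatrix}\\ * & -S-T-T^T & hT^T & 0 & 0\\ * & * & -hR & 0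 & 0\\ * & * & * & -\mu R_a & 0\\ * & * & * & * & -\mu F R_a\end{bmatrix}<0,$$ where $$P=\begin{bmatrix}P_1&0\\P_2&P_3\end{bmatrix},\quad Y=[\,Y_1\ \ Y_2\,],\quad \Psi=P^T\begin{bmatrix}0&I\\A_0&-I\end{bmatrix}+\begin{bmatrix}0&A_0^T\\I&-I\end{bmatrix}P+\begin{bmatrix}S&0\\0&hR\end{bmatrix}+\begin{bmatrix}Y\\0\end{bmatrix}+\begin{bmatrix}Y\\0\end{bmatrix}^T .$$ (Case C.) Let $0\le p<\infty$. If $\mathrm{LMI}(\mathcal F(p))$ is feasible, then the system is asymptotically stable for every such delay $\tau$ that is differentiable almost everywhere with $\dot\tau(t)\le 1+p$, where the bound on the derivative is understood to control the increments, i.e. $\tau(t)-\tau(s)\le(1+p)(t-s)$ for $0\le s\le t$ (as is automatic if $\tau$ is locally absolutely continuous). (Case B.) If $\mathrm{LMI}(7/4)$ is feasible, then the system is asymptotically stable for every such delay $\tau$ that is measurable. Here solutions with initial time $t_0\ge 0$ have a continuous initial function on $[t_0-h-\mu,t_0]$, are locally absolutely continuous on $[t_0,\infty)$ and satisfy the equation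 for almost all $t>t_0$. The system is asymptotically stable if, for every $t_0\ge0$, for each $\varepsilon>0$ there is $\delta>0$ such that a sup norm of the initial function smaller than $\delta$ implies $\|x(t)\|<\varepsilon$ for all $t\ge t_0$, and every solution tends to $0$ as $t\to\infty$. -/

import Mathlib

open MeasureTheory Filter Topology

noncomputable section

namespace DelayLMI

/-- The factor `𝓕(p)`, `0 ≤ p < ∞`, in the bound on the delay operator for delays whose derivative
is at most `1 + p`. -/
def boundFactor (p : ℝ) : ℝ :=
  if p < 1 then (2 * p + 1) / (p + 1) else (7 * p - 1) / (4 * p)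

/-- The value `𝓕(∞) = 7/4` for delays without any constraint on the derivative. -/
def boundFactorTop : ℝ := 7 / 4

/-! ### Delays -/

/-- `τ(t) = h + η(t)` with `|η(t)| ≤ μ ≤ h`, for all times `t ≥ 0`. -/
def IsUncertainDelay (h μ : ℝ) (τ : ℝ → ℝ) : Prop :=
  μ ≤ h ∧ ∃ η : ℝ → ℝ, ∀ t, 0 ≤ t → τ t = h + η t ∧ |η t| ≤ μ

/-- Fast-varying delay: `τ` is (Lebesgue) measurable on `[0, ∞)`. -/
def IsFastVarying (τ : ℝ → ℝ) : Prop :=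
  AEMeasurable τ (volume.restrict (Set.Ici 0))

/-- Moderately-varying delay: `p ≥ 0` and `τ` is differentiable almost everywhere on `[0, ∞)` with
derivative at most `1 + p`, this bound being understood to control the increments of `τ`.
For a locally absolutely continuous `τ` (and also for one with downward jumps, such as a sawtooth)
the last field follows from the bound on the derivative; it only excludes an increase of `τ` that
the derivative does not see, i.e. upward jumps and a singular (Cantor type) increasing part. -/
structure IsModeratelyVarying (p : ℝ) (τ : ℝ → ℝ) : Prop where
  nonneg : 0 ≤ p
  ae_deriv_le : ∀ᵐ t : ℝ, 0 < t → DifferentiableAt ℝ τ t ∧ deriv τ t ≤ 1 + p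
  increment_le : ∀ s t, 0 ≤ s → s ≤ t → τ t - τ s ≤ (1 + p) * (t - s)

/-! ### The delay system and its asymptotic stability -/

variable {n : ℕ}

/-- `x` is a (Carathéodory) solution, for `t ≥ t₀`, of `ẋ(t) = A₀ x(t) + A₁ x(t - τ(t))`, with a
continuous initial function on `[t₀ - r, t₀]`. -/
structure IsSolution (A₀ A₁ : Matrix (Fin n) (Fin n) ℝ) (τ : ℝ → ℝ) (r t₀ : ℝ)
    (x : ℝ → EuclideanSpace ℝ (Fin n)) : Prop where
  continuousOn : ContinuousOn x (Set.Ici (t₀ - r))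
  absolutelyContinuous : ∀ t, t₀ ≤ t → AbsolutelyContinuousOnInterval x t₀ t
  ae_hasDerivAt : ∀ᵐ t : ℝ, t₀ < t →
    HasDerivAt x (Matrix.toEuclideanLin A₀ (x t) + Matrix.toEuclideanLin A₁ (x (t - τ t))) t

/-- Asymptotic stability of `ẋ(t) = A₀ x(t) + A₁ x(t - τ(t))`, where `0 ≤ τ(t) ≤ r` for `t ≥ 0`:
for every initial time `t₀ ≥ 0` the zero solution is Lyapunov stable (with respect to the sup norm
of the initial function on `[t₀ - r, t₀]`) and every solution tends to zero. -/
def IsAsymptoticallyStable (A₀ A₁ : Matrix (Fin n) (Fin n) ℝ) (τ : ℝ → ℝ) (r : ℝ) : Prop :=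
  ∀ t₀ : ℝ, 0 ≤ t₀ →
    (∀ ε : ℝ, 0 < ε → ∃ δ : ℝ, 0 < δ ∧ ∀ x : ℝ → EuclideanSpace ℝ (Fin n),
      IsSolution A₀ A₁ τ r t₀ x → (∀ s ∈ Set.Icc (t₀ - r) t₀, ‖x s‖ < δ) →
        ∀ t, t₀ ≤ t → ‖x t‖ < ε) ∧
    (∀ x : ℝ → EuclideanSpace ℝ (Fin n), IsSolution A₀ A₁ τ r t₀ x → Tendsto x atTop (𝓝 0))

/-! ### The linear matrix inequality -/

/-- `P = [P₁ 0; P₂ P₃]`. -/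
def matP (P₁ P₂ P₃ : Matrix (Fin n) (Fin n) ℝ) : Matrix (Fin n ⊕ Fin n) (Fin n ⊕ Fin n) ℝ :=
  Matrix.fromBlocks P₁ 0 P₂ P₃

/-- `Y = [Y₁ Y₂]`. -/
def matY (Y₁ Y₂ : Matrix (Fin n) (Fin n) ℝ) : Matrix (Fin n) (Fin n ⊕ Fin n) ℝ :=
  Matrix.fromCols Y₁ Y₂

/-- The block `Ψ = Pᵀ [0 I; A₀ -I] + [0 A₀ᵀ; I -I] P + diag(S, h R) + [Y; 0] + [Y; 0]ᵀ`. -/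
def matPsi (A₀ : Matrix (Fin n) (Fin n) ℝ) (h : ℝ)
    (P : Matrix (Fin n ⊕ Fin n) (Fin n ⊕ Fin n) ℝ) (Y : Matrix (Fin n) (Fin n ⊕ Fin n) ℝ)
    (S R : Matrix (Fin n) (Fin n) ℝ) : Matrix (Fin n ⊕ Fin n) (Fin n ⊕ Fin n) ℝ :=
  P.transpose * Matrix.fromBlocks 0 1 A₀ (-1)
    + Matrix.fromBlocks 0 A₀.transpose 1 (-1) * P
    + Matrix.fromBlocks S 0 0 (h • R)
    + Matrix.fromRows Y 0 + (Matrix.fromRows Y 0).transpose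

/-- The symmetric block matrix `[A B; * D]`, where `*` stands for `Bᵀ`. -/
def symBlocks {k l : Type*} (A : Matrix k k ℝ) (B : Matrix k l ℝ) (D : Matrix l l ℝ) :
    Matrix (k ⊕ l) (k ⊕ l) ℝ :=
  Matrix.fromBlocks A B B.transpose D

/-- The matrix
`Γ = [Ψ, Pᵀ[0; A₁] - Yᵀ + [T; 0], h Yᵀ; *, -S - T - Tᵀ, h Tᵀ; *, *, -h R]`. -/
def matGamma (A₀ A₁ : Matrix (Fin n) (Fin n) ℝ) (h : ℝ)
    (P : Matrix (Fin n ⊕ Fin n) (Fin n ⊕ Fin n) ℝ) (Y : Matrix (Fin n) (Fin n ⊕ Fin n) ℝ)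
    (S T R : Matrix (Fin n) (Fin n) ℝ) :
    Matrix (((Fin n ⊕ Fin n) ⊕ Fin n) ⊕ Fin n) (((Fin n ⊕ Fin n) ⊕ Fin n) ⊕ Fin n) ℝ :=
  symBlocks
    (symBlocks (matPsi A₀ h P Y S R)
      (P.transpose * Matrix.fromRows 0 A₁ - Y.transpose + Matrix.fromRows T 0)
      (-S - T - T.transpose))
    (Matrix.fromRows (h • Y.transpose) (h • T.transpose))
    (-(h • R))

/-- The column `[B; C; 0; 0]` of the outer block matrix. -/
def outerCol (B C : Matrix (Fin n) (Fin n) ℝ) :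
    Matrix (((Fin n ⊕ Fin n) ⊕ Fin n) ⊕ Fin n) (Fin n) ℝ :=
  Matrix.fromRows (Matrix.fromRows (Matrix.fromRows B C) 0) 0

/-- The matrix of the linear matrix inequality:
`[Γ, [μ P₂ᵀ A₁; μ P₃ᵀ A₁; 0; 0], [0; μ F Rₐ; 0; 0]; *, -μ Rₐ, 0; *, *, -μ F Rₐ]`. -/
def lmiMatrix (A₀ A₁ : Matrix (Fin n) (Fin n) ℝ) (h μ F : ℝ)
    (P₁ P₂ P₃ S Y₁ Y₂ T R Rₐ : Matrix (Fin n) (Fin n) ℝ) :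
    Matrix ((((Fin n ⊕ Fin n) ⊕ Fin n) ⊕ Fin n) ⊕ (Fin n ⊕ Fin n))
      ((((Fin n ⊕ Fin n) ⊕ Fin n) ⊕ Fin n) ⊕ (Fin n ⊕ Fin n)) ℝ :=
  symBlocks (matGamma A₀ A₁ h (matP P₁ P₂ P₃) (matY Y₁ Y₂) S T R)
    (Matrix.fromCols
      (outerCol (μ • (P₂.transpose * A₁)) (μ • (P₃.transpose * A₁)))
      (outerCol 0 ((μ * F) • Rₐ)))
    (symBlocks (-(μ • Rₐ)) 0 (-((μ * F) • Rₐ)))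

/-- Feasibility of the linear matrix inequality with the value `F` of `𝓕`; `M < 0` means that `-M`
is symmetric and positive definite. -/
def LMIFeasible (A₀ A₁ : Matrix (Fin n) (Fin n) ℝ) (h μ F : ℝ) : Prop :=
  ∃ P₁ P₂ P₃ S Y₁ Y₂ T R Rₐ : Matrix (Fin n) (Fin n) ℝ,
    P₁.PosDef ∧ S.PosDef ∧ (-(lmiMatrix A₀ A₁ h μ F P₁ P₂ P₃ S Y₁ Y₂ T R Rₐ)).PosDef

end DelayLMI

end

/-! Write `x(t - τ) = x(t - h) - u(t)`, where `u(t)` is the integral of `ẋ` from `t - τ(t)` to `t -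
h`. Evaluate the quadratic form of the LMI at `(x, ẋ, x(t-h), -(x - x(t-h))/h, -u/μ, ẋ)`. The terms
carrying the multipliers `P₂, P₃, Y₁, Y₂, T` vanish (`lmiMatrix_form_trajectory`). What remains is
the derivative of `xᵀP₁x`, a difference of `S` terms at `t` and `t - h`, and two pairs of terms in
`R` and `Rₐ`. Their sum is at most `-ε(|x|² + |ẋ|²)`.

Integrate this over `(t₁, T]`. The `S` terms telescope. The negative `R` and `Rₐ` terms are
quadratic in integrals of `ẋ` over intervals of varying position, so they are absorbed by the
positive ones as soon as the operator taking `w` to its integral between `t - τ(t)` and `t - h` has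
squared `L²` norm at most `Fμ²` (`DelayBound`). Hence `xᵀP₁x` at `T` and the integral of `|x|² +
|ẋ|²` are bounded by data on a finite window (`energy_le`). A Gronwall type bound controls that
window by the initial function, which gives stability. Square integrability of `x` and `ẋ` gives
convergence to zero.

The values of `𝓕` come from two Schur tests for the indicator kernel `K` of the intervals between
`g(t)` and `t`, with `|t - g(t)| ≤ μ`. Testing `K*K` gives `2 - 1/(1+p)`
(`lintegral_sq_delay_le_of_nonneg`). Testing `KK*` means summing the overlaps of one interval with
all the others. That interval lies in a window of length `μ`. Times on the two sides of the window
contribute `μ²/2` each, and times inside it contribute `3μ²/4` in general or `(3/4 - 1/(4p))μ²`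
under the slope bound (`lintegral_overlap_le`). The totals are `7/4` and `(7p-1)/(4p)`. -/

open scoped ENNReal

/-! ### Schur tests for nonnegative kernels. -/

theorem lintegral_mul_sq_le {α : Type*} [MeasurableSpace α] (ν : Measure α) {f g : α → ℝ≥0∞}
    (hf : AEMeasurable f ν) (hg : AEMeasurable g ν) :
    (∫⁻ a, f a * g a ∂ν) ^ 2 ≤ (∫⁻ a, f a ^ 2 ∂ν) * ∫⁻ a, g a ^ 2 ∂ν := by
  have h := ENNReal.lintegral_mul_le_Lp_mul_Lq ν Real.HolderConjugate.two_two hf hg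
  simp only [Pi.mul_apply, ENNReal.rpow_two] at h
  have key : ∀ x : ℝ≥0∞, (x ^ (1 / (2 : ℝ))) ^ 2 = x := fun x => by
    rw [← ENNReal.rpow_natCast, ← ENNReal.rpow_mul]; norm_num
  calc _ ≤ ((∫⁻ a, f a ^ 2 ∂ν) ^ (1 / (2 : ℝ)) * (∫⁻ a, g a ^ 2 ∂ν) ^ (1 / (2 : ℝ))) ^ 2 := by gcongr
    _ = _ := by rw [mul_pow, key, key]

/-- Schur test for `K* K` with the constant test function. -/
theorem schur_col {k : ℝ → ℝ → ℝ≥0∞} (hk : Measurable (Function.uncurry k)) {C : ℝ≥0∞}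
    (hC : ∀ s, ∫⁻ t, k t s * ∫⁻ s', k t s' ≤ C) {w : ℝ → ℝ≥0∞} (hw : Measurable w) :
    ∫⁻ t, (∫⁻ s, k t s * w s) ^ 2 ≤ C * ∫⁻ s, w s ^ 2 := by
  have hkt : ∀ t, Measurable (k t) := fun t => hk.comp measurable_prodMk_left
  have hks : ∀ s, Measurable fun t => k t s := fun s => hk.comp measurable_prodMk_right
  have hM : Measurable fun t => ∫⁻ s', k t s' := hk.lintegral_prod_right
  have hsqrt : ∀ x : ℝ≥0∞, (x ^ (1 / (2 : ℝ))) ^ 2 = x := fun x => by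
    rw [← ENNReal.rpow_natCast, ← ENNReal.rpow_mul]; norm_num
  -- Cauchy–Schwarz after splitting `k = √k · √k`.
  have h1 : ∀ t, (∫⁻ s, k t s * w s) ^ 2 ≤ ∫⁻ s, (k t s * ∫⁻ s', k t s') * w s ^ 2 := by
    intro t
    have := lintegral_mul_sq_le volume (f := fun s => k t s ^ (1 / (2 : ℝ)))
      (g := fun s => k t s ^ (1 / (2 : ℝ)) * w s) ((hkt t).pow_const _).aemeasurable
      (((hkt t).pow_const _).mul hw).aemeasurable
    have e : ∀ s, k t s ^ (1 / (2 : ℝ)) * (k t s ^ (1 / (2 : ℝ)) * w s) = k t s * w s := by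
      intro s; rw [← mul_assoc, ← sq, hsqrt]
    simp only [e, mul_pow, hsqrt] at this
    refine this.trans (le_of_eq ?_)
    rw [← lintegral_const_mul _ (by exact (hkt t).mul (hw.pow_const 2))]
    congr 1; ext s; ring
  calc _ ≤ ∫⁻ t, ∫⁻ s, (k t s * ∫⁻ s', k t s') * w s ^ 2 := lintegral_mono h1
    _ = ∫⁻ s, ∫⁻ t, (k t s * ∫⁻ s', k t s') * w s ^ 2 := by
        refine lintegral_lintegral_swap (Measurable.aemeasurable ?_)
        exact (hk.mul (hM.comp measurable_fst)).mul ((hw.comp measurable_snd).pow_const 2)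
    _ ≤ ∫⁻ s, C * w s ^ 2 := by
        refine lintegral_mono fun s => ?_
        dsimp only
        rw [lintegral_mul_const _ (by exact (hks s).mul hM)]
        gcongr; exact hC s
    _ = _ := lintegral_const_mul _ (hw.pow_const 2)

/-- Schur test for `K K*` with the constant test function. -/
theorem schur_row {k : ℝ → ℝ → ℝ≥0∞} (hk : Measurable (Function.uncurry k)) {C : ℝ≥0∞}
    (hC : ∀ t, ∫⁻ t', ∫⁻ s, k t s * k t' s ≤ C) {w : ℝ → ℝ≥0∞} (hw : Measurable w)
    (hfin : ∫⁻ t, (∫⁻ s, k t s * w s) ^ 2 ≠ ∞) :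
    ∫⁻ t, (∫⁻ s, k t s * w s) ^ 2 ≤ C * ∫⁻ s, w s ^ 2 := by
  have hkt : ∀ t, Measurable (k t) := fun t => hk.comp measurable_prodMk_left
  have hks : ∀ s, Measurable fun t => k t s := fun s => hk.comp measurable_prodMk_right
  set u : ℝ → ℝ≥0∞ := fun t => ∫⁻ s, k t s * w s with hu
  have hum : Measurable u := Measurable.lintegral_prod_right (hk.mul (hw.comp measurable_snd))
  set v : ℝ → ℝ≥0∞ := fun s => ∫⁻ t, k t s * u t with hv
  have hvm : Measurable v := Measurable.lintegral_prod_left (hk.mul (hum.comp measurable_fst))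
  have huv : ∫⁻ t, u t ^ 2 = ∫⁻ s, w s * v s := by
    calc ∫⁻ t, u t ^ 2 = ∫⁻ t, ∫⁻ s, k t s * w s * u t := by
          refine lintegral_congr fun t => ?_
          rw [lintegral_mul_const _ (by exact (hkt t).mul hw), sq]
      _ = ∫⁻ s, ∫⁻ t, k t s * w s * u t := by
          refine lintegral_lintegral_swap (Measurable.aemeasurable ?_)
          exact (hk.mul (hw.comp measurable_snd)).mul (hum.comp measurable_fst)
      _ = _ := by
          refine lintegral_congr fun s => ?_
          rw [hv]
          dsimp only
          rw [← lintegral_const_mul _ (by exact (hks s).mul hum)]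
          refine lintegral_congr fun t => ?_
          ring
  have hG : Measurable fun q : ℝ × ℝ => ∫⁻ s, k q.1 s * k q.2 s := by
    refine Measurable.lintegral_prod_right (f := fun (q : ℝ × ℝ) s => k q.1 s * k q.2 s) ?_
    exact (hk.comp (by fun_prop : Measurable fun q : (ℝ × ℝ) × ℝ => (q.1.1, q.2))).mul
      (hk.comp (by fun_prop : Measurable fun q : (ℝ × ℝ) × ℝ => (q.1.2, q.2)))
  have hvv : ∫⁻ s, v s ^ 2 = ∫⁻ t, ∫⁻ t', (∫⁻ s, k t s * k t' s) * (u t * u t') := by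
    calc ∫⁻ s, v s ^ 2 = ∫⁻ s, ∫⁻ t, ∫⁻ t', (k t s * u t) * (k t' s * u t') := by
          refine lintegral_congr fun s => ?_
          rw [sq]
          nth_rw 1 [hv]
          dsimp only
          rw [← lintegral_mul_const _ (by exact (hks s).mul hum)]
          refine lintegral_congr fun t => ?_
          rw [← lintegral_const_mul _ (by exact (hks s).mul hum)]
      _ = ∫⁻ t, ∫⁻ s, ∫⁻ t', (k t s * u t) * (k t' s * u t') := by
          refine lintegral_lintegral_swap (Measurable.aemeasurable ?_)
          refine Measurable.lintegral_prod_right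
            (f := fun (q : ℝ × ℝ) t' => (k q.2 q.1 * u q.2) * (k t' q.1 * u t')) ?_
          exact ((hk.comp (by fun_prop : Measurable fun q : (ℝ × ℝ) × ℝ => (q.1.2, q.1.1))).mul
            (hum.comp (by fun_prop))).mul
            ((hk.comp (by fun_prop : Measurable fun q : (ℝ × ℝ) × ℝ => (q.2, q.1.1))).mul
            (hum.comp (by fun_prop)))
      _ = _ := by
          refine lintegral_congr fun t => ?_
          rw [lintegral_lintegral_swap]
          · refine lintegral_congr fun t' => ?_
            rw [← lintegral_mul_const _ (by exact (hkt t).mul (hkt t'))]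
            refine lintegral_congr fun s => ?_
            ring
          · refine Measurable.aemeasurable ?_
            exact (((hkt t).comp measurable_fst).mul measurable_const).mul
              ((hk.comp measurable_swap).mul (hum.comp measurable_snd))
  have hCu : ∫⁻ t, ∫⁻ t', (∫⁻ s, k t s * k t' s) * u t ^ 2 ≤ C * ∫⁻ t, u t ^ 2 := by
    rw [← lintegral_const_mul _ (hum.pow_const 2)]
    refine lintegral_mono fun t => ?_
    dsimp only
    rw [lintegral_mul_const _ (by exact hG.comp measurable_prodMk_left)]
    gcongr; exact hC t
  -- With `u = Kw` and `v = K*u`, `‖v‖² = ⟨KK*u, u⟩`. Since the kernel of `KK*` is symmetric,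
  -- `2u(t)u(t') ≤ u(t)² + u(t')²` reduces this to the row sums.
  have hv2 : ∫⁻ s, v s ^ 2 ≤ C * ∫⁻ t, u t ^ 2 := by
    have h2 : 2 * ∫⁻ s, v s ^ 2 ≤ 2 * (C * ∫⁻ t, u t ^ 2) := by
      have amgm : ∀ a b : ℝ≥0∞, 2 * (a * b) ≤ a ^ 2 + b ^ 2 := by
        intro a b
        rcases eq_or_ne a ∞ with rfl | ha
        · simp
        rcases eq_or_ne b ∞ with rfl | hb
        · simp
        lift a to NNReal using ha
        lift b to NNReal using hb
        norm_cast
        have := two_mul_le_add_sq a b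
        rwa [mul_assoc] at this
      have hm1 : Measurable fun q : ℝ × ℝ => (∫⁻ s, k q.1 s * k q.2 s) * u q.1 ^ 2 :=
        hG.mul ((hum.comp measurable_fst).pow_const 2)
      have hm2 : Measurable fun q : ℝ × ℝ => (∫⁻ s, k q.1 s * k q.2 s) * u q.2 ^ 2 :=
        hG.mul ((hum.comp measurable_snd).pow_const 2)
      have hm3 : Measurable fun q : ℝ × ℝ => (∫⁻ s, k q.1 s * k q.2 s) * (u q.1 * u q.2) :=
        hG.mul ((hum.comp measurable_fst).mul (hum.comp measurable_snd))
      rw [hvv, ← lintegral_const_mul _ hm3.lintegral_prod_right']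
      calc _ ≤ ∫⁻ t, ((∫⁻ t', (∫⁻ s, k t s * k t' s) * u t ^ 2)
              + ∫⁻ t', (∫⁻ s, k t s * k t' s) * u t' ^ 2) := by
            refine lintegral_mono fun t => ?_
            dsimp only
            rw [← lintegral_const_mul _ (by exact hm3.comp measurable_prodMk_left),
              ← lintegral_add_left (by exact hm1.comp measurable_prodMk_left)]
            refine lintegral_mono fun t' => ?_
            dsimp only
            rw [← mul_add, mul_left_comm]
            gcongr; exact amgm _ _
        _ = (∫⁻ t, ∫⁻ t', (∫⁻ s, k t s * k t' s) * u t ^ 2)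
              + ∫⁻ t, ∫⁻ t', (∫⁻ s, k t s * k t' s) * u t' ^ 2 :=
            lintegral_add_left hm1.lintegral_prod_right' _
        _ = (∫⁻ t, ∫⁻ t', (∫⁻ s, k t s * k t' s) * u t ^ 2)
              + ∫⁻ t, ∫⁻ t', (∫⁻ s, k t s * k t' s) * u t ^ 2 := by
            congr 1
            rw [lintegral_lintegral_swap hm2.aemeasurable]
            refine lintegral_congr fun t => lintegral_congr fun t' => ?_
            congr 1
            exact lintegral_congr fun s => mul_comm _ _
        _ ≤ _ := by rw [two_mul]; gcongr
    exact (ENNReal.mul_le_mul_iff_right (by norm_num) (by norm_num)).1 h2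
  rcases eq_or_ne (∫⁻ t, u t ^ 2) 0 with h0 | h0
  · rw [h0]; exact zero_le
  -- From `‖u‖² = ⟨w, v⟩` one gets `‖u‖⁴ ≤ C‖u‖²‖w‖²`. Cancelling `‖u‖²` is what requires `hfin`.
  have h3 : (∫⁻ t, u t ^ 2) * (∫⁻ t, u t ^ 2) ≤ (∫⁻ t, u t ^ 2) * (C * ∫⁻ s, w s ^ 2) := by
    calc _ = (∫⁻ s, w s * v s) ^ 2 := by rw [← sq, huv]
      _ ≤ (∫⁻ s, w s ^ 2) * ∫⁻ s, v s ^ 2 :=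
        lintegral_mul_sq_le volume hw.aemeasurable hvm.aemeasurable
      _ ≤ (∫⁻ s, w s ^ 2) * (C * ∫⁻ t, u t ^ 2) := by gcongr
      _ = _ := by ring
  exact (ENNReal.mul_le_mul_iff_right h0 hfin).1 h3

/-! ### Rearrangement and the overlap estimate inside a window of length `μ`. -/

theorem lintegral_Ioc_le_affine {a b m c : ℝ} (hab : a ≤ b) {f : ℝ → ℝ≥0∞}
    (hf : ∀ x ∈ Set.Ioc a b, f x ≤ ENNReal.ofReal (m * x + c))
    (h0 : ∀ x ∈ Set.Ioc a b, 0 ≤ m * x + c) :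
    ∫⁻ x in Set.Ioc a b, f x ≤ ENNReal.ofReal (m * (b ^ 2 - a ^ 2) / 2 + c * (b - a)) := by
  have hc : Continuous fun x : ℝ => m * x + c := by fun_prop
  have hi : IntegrableOn (fun x : ℝ => m * x + c) (Set.Ioc a b) :=
    (hc.integrableOn_Icc).mono_set Set.Ioc_subset_Icc_self
  calc _ ≤ ∫⁻ x in Set.Ioc a b, ENNReal.ofReal (m * x + c) :=
        setLIntegral_mono (by fun_prop) hf
    _ = ENNReal.ofReal (∫ x in Set.Ioc a b, (m * x + c)) := by
        rw [ofReal_integral_eq_lintegral_ofReal hi]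
        exact (ae_restrict_iff' measurableSet_Ioc).2 (Eventually.of_forall h0)
    _ = _ := by
        rw [← intervalIntegral.integral_of_le hab, intervalIntegral.integral_add
          (by apply Continuous.intervalIntegrable; fun_prop) (by simp),
          intervalIntegral.integral_const_mul]
        simp only [integral_id, intervalIntegral.integral_const, smul_eq_mul]
        congr 1; ring

theorem lintegral_Ioc_split {a b c : ℝ} (hab : a ≤ b) (hbc : b ≤ c) (f : ℝ → ℝ≥0∞) :
    ∫⁻ x in Set.Ioc a c, f x = (∫⁻ x in Set.Ioc a b, f x) + ∫⁻ x in Set.Ioc b c, f x := by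
  rw [← Set.Ioc_union_Ioc_eq_Ioc hab hbc,
    lintegral_union measurableSet_Ioc (Set.Ioc_disjoint_Ioc_of_le le_rfl)]

/-- The tail function of Lebesgue measure on a bounded set `S` pushes the measure on `S` forward to
Lebesgue measure on `(0, |S|]`. -/
theorem setLIntegral_comp_measureReal_Ioi {S : Set ℝ} {a b : ℝ}
    (hab : a ≤ b) (hSab : S ⊆ Set.Ioc a b) {ψ : ℝ → ℝ≥0∞} (hψ : Measurable ψ) :
    ∫⁻ θ in S, ψ (volume.real (S ∩ Set.Ioi θ)) = ∫⁻ x in Set.Ioc 0 (volume.real S), ψ x := by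
  have hfin : volume S ≠ ∞ := ((measure_mono hSab).trans_lt (by simp)).ne
  have hfin' : ∀ B : Set ℝ, volume (S ∩ B) ≠ ∞ := fun B =>
    ((measure_mono Set.inter_subset_left).trans_lt hfin.lt_top).ne
  set F : ℝ → ℝ := fun θ => volume.real (S ∩ Set.Ioi θ) with hF
  have hanti : Antitone F := fun x y hxy =>
    measureReal_mono (Set.inter_subset_inter_right _ (Set.Ioi_subset_Ioi hxy)) (hfin' _)
  have hlip : ∀ x y, x ≤ y → F x - F y ≤ y - x := by
    intro x y hxy
    have h1 : S ∩ Set.Ioi x ⊆ (S ∩ Set.Ioi y) ∪ Set.Ioc x y := by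
      rintro z ⟨hz, hxz⟩
      rcases lt_or_ge y z with h | h
      · exact Or.inl ⟨hz, h⟩
      · exact Or.inr ⟨hxz, h⟩
    have h2 := (measureReal_mono (μ := volume) h1
      (((measure_union_le _ _).trans_lt (ENNReal.add_lt_top.2 ⟨(hfin' _).lt_top, by simp⟩)).ne)).trans
      (measureReal_union_le _ _)
    rw [Real.volume_real_Ioc_of_le hxy] at h2
    simp only [hF]; linarith
  have hcont : Continuous F := by
    refine LipschitzWith.continuous (K := 1) (LipschitzWith.of_dist_le_mul fun x y => ?_)
    rw [NNReal.coe_one, one_mul, Real.dist_eq, Real.dist_eq]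
    rcases le_total x y with h | h
    · rw [abs_of_nonneg (sub_nonneg.2 (hanti h)), abs_sub_comm, abs_of_nonneg (sub_nonneg.2 h)]
      exact hlip _ _ h
    · rw [abs_sub_comm, abs_of_nonneg (sub_nonneg.2 (hanti h)), abs_of_nonneg (sub_nonneg.2 h)]
      exact hlip _ _ h
  have hFa : F a = volume.real S := by
    simp only [hF]; congr 1
    exact Set.inter_eq_left.2 fun z hz => (hSab hz).1
  have hFb : F b = 0 := by
    simp only [hF]
    rw [show S ∩ Set.Ioi b = ∅ from ?_]; · simp
    ext z; simp only [Set.mem_inter_iff, Set.mem_Ioi, Set.mem_empty_iff_false, iff_false, not_and]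
    exact fun hz => not_lt.2 (hSab hz).2
  have hF0 : ∀ θ, 0 ≤ F θ := fun θ => measureReal_nonneg
  have hFc : ∀ θ, F θ ≤ volume.real S := fun θ => measureReal_mono Set.inter_subset_left hfin
  have : IsFiniteMeasure (volume.restrict S) := ⟨by simpa using hfin.lt_top⟩
  have hmap : Measure.map F (volume.restrict S) = volume.restrict (Set.Ioc 0 (volume.real S)) := by
    have := Measure.isFiniteMeasure_map (volume.restrict S) F
    refine Measure.ext_of_Iic _ _ fun x => ?_
    rw [Measure.map_apply hcont.measurable measurableSet_Iic,
      Measure.restrict_apply (hcont.measurable measurableSet_Iic),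
      Measure.restrict_apply measurableSet_Iic]
    rcases lt_or_ge x 0 with hx | hx
    · rw [show F ⁻¹' Set.Iic x ∩ S = ∅ from ?_, show Set.Iic x ∩ Set.Ioc 0 (volume.real S) = ∅ from ?_]
      · ext z; simp only [Set.mem_inter_iff, Set.mem_Iic, Set.mem_Ioc, Set.mem_empty_iff_false,
          iff_false, not_and]
        intro h1 h2; linarith
      · ext z; simp only [Set.mem_inter_iff, Set.mem_preimage, Set.mem_Iic,
          Set.mem_empty_iff_false, iff_false, not_and]
        intro h1; linarith [hF0 z]
    rcases le_or_gt (volume.real S) x with hx' | hx'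
    · rw [show F ⁻¹' Set.Iic x ∩ S = S from ?_,
        show Set.Iic x ∩ Set.Ioc 0 (volume.real S) = Set.Ioc 0 (volume.real S) from ?_]
      · rw [Real.volume_Ioc, sub_zero, Measure.real, ENNReal.ofReal_toReal hfin]
      · exact Set.inter_eq_right.2 fun z hz => hz.2.trans hx'
      · exact Set.inter_eq_right.2 fun z _ => (hFc z).trans hx'
    -- At the least `θ₀` with `F θ₀ = x`, the sublevel set `{F ≤ x}` meets `S` exactly in `S ∩ [θ₀,
    -- ∞)`. Up to the point `θ₀` this has measure `F θ₀ = x`.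
    have hne : (Set.Icc a b ∩ F ⁻¹' {x}).Nonempty := by
      obtain ⟨θ, h1, h2⟩ := intermediate_value_Icc' hab hcont.continuousOn
        (show x ∈ Set.Icc (F b) (F a) by rw [hFa, hFb]; exact ⟨hx, hx'.le⟩)
      exact ⟨θ, h1, h2⟩
    obtain ⟨θ₀, ⟨h1, h2⟩, h3⟩ := (isCompact_Icc.inter_right
      (isClosed_singleton.preimage hcont)).exists_isLeast hne
    have h2' : F θ₀ = x := h2
    have hset : F ⁻¹' Set.Iic x ∩ S = S ∩ Set.Ici θ₀ := by
      ext z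
      simp only [Set.mem_inter_iff, Set.mem_preimage, Set.mem_Iic, Set.mem_Ici]
      constructor
      · rintro ⟨hz, hzS⟩
        refine ⟨hzS, ?_⟩
        by_contra hlt
        push Not at hlt
        have : F z = x := le_antisymm hz (h2' ▸ hanti hlt.le)
        exact absurd (h3 ⟨⟨(hSab hzS).1.le, (hSab hzS).2⟩, this⟩) (not_le.2 hlt)
      · rintro ⟨hzS, hz⟩
        exact ⟨h2' ▸ hanti hz, hzS⟩
    have hx2 : Set.Iic x ∩ Set.Ioc 0 (volume.real S) = Set.Ioc 0 x := by
      ext z; simp only [Set.mem_inter_iff, Set.mem_Iic, Set.mem_Ioc]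
      constructor
      · rintro ⟨h1, h2, h3⟩; exact ⟨h2, h1⟩
      · rintro ⟨h1, h2⟩; exact ⟨h2, h1, h2.trans hx'.le⟩
    have hae : (S ∩ Set.Ici θ₀ : Set ℝ) =ᵐ[volume] (S ∩ Set.Ioi θ₀ : Set ℝ) :=
      (ae_eq_refl S).inter Ioi_ae_eq_Ici.symm
    rw [hset, hx2, measure_congr hae, Real.volume_Ioc, sub_zero, ← h2']
    simp only [hF, Measure.real]
    rw [ENNReal.ofReal_toReal (hfin' _)]
  rw [← hmap, lintegral_map hψ hcont.measurable]

theorem setLIntegral_comp_measureReal_Iio {S : Set ℝ} {a b : ℝ}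
    (hab : a ≤ b) (hSab : S ⊆ Set.Ioc a b) {ψ : ℝ → ℝ≥0∞} (hψ : Measurable ψ) :
    ∫⁻ θ in S, ψ (volume.real (S ∩ Set.Iio θ)) = ∫⁻ x in Set.Ioc 0 (volume.real S), ψ x := by
  have hneg : ∀ A : Set ℝ, volume.real (-A) = volume.real A := fun A => by
    simp [Measure.real, Measure.measure_neg]
  -- Reflection turns `(a, b]` into `[-b, -a)`; the left end `-b - 1` makes room for the point `-b`.
  have h := setLIntegral_comp_measureReal_Ioi (S := -S) (a := -b - 1) (b := -a)
    (by linarith) (fun z hz => by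
      have := hSab (Set.mem_neg.1 hz)
      constructor <;> linarith [this.1, this.2]) hψ
  rw [hneg] at h
  have hI : ∀ θ : ℝ, (-S ∩ Set.Ioi (-θ)) = -(S ∩ Set.Iio θ) := fun θ => by
    ext z; simp only [Set.mem_inter_iff, Set.mem_neg, Set.mem_Ioi, Set.mem_Iio, neg_lt]
  rw [← h, ← Set.image_neg_eq_neg,
    ← (Measure.measurePreserving_neg (volume : Measure ℝ)).setLIntegral_comp_emb
      (MeasurableEquiv.neg ℝ).measurableEmbedding, Set.image_neg_eq_neg]
  simp only [hI, hneg]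

/-- Any break point `s` gives an upper bound: use the second argument of the minimum before `s` and
the first after it. The best `s` is chosen later. -/
theorem lintegral_min_affine_le {c d p s : ℝ} (hd : 0 ≤ d) (hp : 0 ≤ p) (hs0 : 0 ≤ s)
    (hsc : s ≤ c) :
    ∫⁻ x in Set.Ioc 0 c, ENNReal.ofReal (min (x + d) ((1 + p) * x)) ≤
      ENNReal.ofReal ((1 + p) * s ^ 2 / 2 + ((c ^ 2 - s ^ 2) / 2 + d * (c - s))) := by
  rw [lintegral_Ioc_split hs0 hsc]
  have h1 := lintegral_Ioc_le_affine (m := 1 + p) (c := 0) hs0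
    (f := fun x => ENNReal.ofReal (min (x + d) ((1 + p) * x)))
    (fun x _ => ENNReal.ofReal_le_ofReal (by rw [add_zero]; exact min_le_right _ _))
    (fun x hx => by have := hx.1; positivity)
  have h2 := lintegral_Ioc_le_affine (m := 1) (c := d) hsc
    (f := fun x => ENNReal.ofReal (min (x + d) ((1 + p) * x)))
    (fun x _ => ENNReal.ofReal_le_ofReal (by rw [one_mul]; exact min_le_left _ _))
    (fun x hx => by have := hx.1; linarith)
  refine (add_le_add h1 h2).trans ?_
  rw [← ENNReal.ofReal_add]
  · refine ENNReal.ofReal_le_ofReal (le_of_eq ?_); ring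
  · rw [zero_mul, add_zero]
    have : 0 ≤ (1 + p) * s ^ 2 / 2 := by positivity
    simpa using this
  · nlinarith [mul_nonneg hd (sub_nonneg.2 hsc), mul_nonneg (sub_nonneg.2 hsc) (by linarith : 0 ≤ c + s)]

/-- The optimal choice of break points. -/
theorem exists_break_points {c d p : ℝ} (hc : 0 ≤ c) (hd : 0 ≤ d) (hp : 1 ≤ p) :
    ∃ s t, (0 ≤ s ∧ s ≤ c) ∧ (0 ≤ t ∧ t ≤ d) ∧
      ((1 + p) * s ^ 2 / 2 + ((c ^ 2 - s ^ 2) / 2 + d * (c - s))) +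
      ((1 + p) * t ^ 2 / 2 + ((d ^ 2 - t ^ 2) / 2 + c * (d - t))) ≤
      (3 / 4 - 1 / (4 * p)) * (c + d) ^ 2 := by
  have hp0 : 0 < p := by linarith
  wlog h : c ≤ d generalizing c d
  · obtain ⟨s, t, hs, ht, hst⟩ := this hd hc (le_of_not_ge h)
    exact ⟨t, s, ht, hs, by rw [add_comm c d]; linarith⟩
  have hcp : c / p ≤ d := by
    rw [div_le_iff₀ hp0]; nlinarith
  by_cases h2 : d ≤ p * c
  · refine ⟨d / p, c / p, ⟨by positivity, by rw [div_le_iff₀ hp0]; linarith⟩,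
      ⟨by positivity, hcp⟩, ?_⟩
    have e : (3 / 4 - 1 / (4 * p)) * (c + d) ^ 2 -
      (((1 + p) * (d / p) ^ 2 / 2 + ((c ^ 2 - (d / p) ^ 2) / 2 + d * (c - d / p))) +
      ((1 + p) * (c / p) ^ 2 / 2 + ((d ^ 2 - (c / p) ^ 2) / 2 + c * (d - c / p)))) =
      (1 + p) / (4 * p) * (c - d) ^ 2 := by
      field_simp; ring
    have : 0 ≤ (1 + p) / (4 * p) * (c - d) ^ 2 := by positivity
    linarith
  · push Not at h2
    refine ⟨c, c / p, ⟨hc, le_rfl⟩, ⟨by positivity, hcp⟩, ?_⟩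
    have e : (3 / 4 - 1 / (4 * p)) * (c + d) ^ 2 -
      (((1 + p) * c ^ 2 / 2 + ((c ^ 2 - c ^ 2) / 2 + d * (c - c))) +
      ((1 + p) * (c / p) ^ 2 / 2 + ((d ^ 2 - (c / p) ^ 2) / 2 + c * (d - c / p)))) =
      ((3 * p - 1) * (c + d) ^ 2 - 2 * p * (1 + p) * c ^ 2 + 2 * c ^ 2 - 2 * p * d ^ 2
        - 4 * p * c * d) / (4 * p) := by
      field_simp; ring
    have : 0 ≤ ((3 * p - 1) * (c + d) ^ 2 - 2 * p * (1 + p) * c ^ 2 + 2 * c ^ 2 - 2 * p * d ^ 2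
        - 4 * p * c * d) := by
      -- In the slack variables `r, q ≥ 0` the polynomial has only nonnegative terms.
      obtain ⟨r, rfl⟩ : ∃ r, p = 1 + r := ⟨p - 1, by ring⟩
      obtain ⟨q, rfl⟩ : ∃ q, d = (1 + r) * c + q := ⟨d - (1 + r) * c, by ring⟩
      have hr : 0 ≤ r := by linarith
      have hq : 0 ≤ q := by linarith
      ring_nf
      positivity
    have := div_nonneg this (by positivity : 0 ≤ 4 * p)
    linarith

/-- The overlap of the intervals between `g θ` and `θ`, `θ ∈ (a, a + μ]`, with `(a, a + μ]`. -/
theorem lintegral_overlap_le {g : ℝ → ℝ} (hg : Measurable g) {p μ a : ℝ} (hp : 1 ≤ p) (hμ : 0 ≤ μ)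
    (hgp : ∀ s t, s ≤ t → g s - g t ≤ p * (t - s)) :
    ∫⁻ θ in Set.Ioc a (a + μ), volume (Set.Ioc a (a + μ) ∩ Set.uIoc (g θ) θ) ≤
      ENNReal.ofReal ((3 / 4 - 1 / (4 * p)) * μ ^ 2) := by
  set J := Set.Ioc a (a + μ) with hJ
  set S := J ∩ {θ | θ ≤ g θ} with hS
  set U := J \ {θ | θ ≤ g θ} with hU
  have hm : MeasurableSet {θ | θ ≤ g θ} := measurableSet_le measurable_id hg
  have hSm : MeasurableSet S := measurableSet_Ioc.inter hm
  have hUm : MeasurableSet U := measurableSet_Ioc.diff hm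
  have hSJ : S ⊆ J := Set.inter_subset_left
  have hUJ : U ⊆ J := Set.sdiff_subset
  have hJfin : volume J ≠ ∞ := by simp [hJ]
  have hfin : ∀ {A : Set ℝ}, A ⊆ J → volume A ≠ ∞ := fun h =>
    ((measure_mono h).trans_lt hJfin.lt_top).ne
  set c := volume.real S with hc
  set d := volume.real U with hd
  have hcd : c + d = μ := by
    rw [hc, hd, ← measureReal_union₀ (hUm.nullMeasurableSet)
      (Set.disjoint_sdiff_inter.symm.aedisjoint) (hfin hSJ) (hfin hUJ),
      Set.inter_union_sdiff, hJ, Real.volume_real_Ioc_of_le (by linarith)]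
    ring
  have hp0 : 0 < 1 + p := by linarith
  -- points with `θ ≤ g θ`
  have hSb : ∀ θ ∈ S, volume (J ∩ Set.uIoc (g θ) θ) ≤
      ENNReal.ofReal (min (volume.real (S ∩ Set.Ioi θ) + d)
        ((1 + p) * volume.real (S ∩ Set.Ioi θ))) := by
    rintro θ ⟨⟨hθ1, hθ2⟩, hθg⟩
    have hθg : θ ≤ g θ := hθg
    set A := min (g θ) (a + μ) - θ with hA
    have hA0 : 0 ≤ A := sub_nonneg.2 (le_min hθg hθ2)
    have hA1 : A ≤ g θ - θ := sub_le_sub_right (min_le_left _ _) _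
    have hA2 : A ≤ a + μ - θ := sub_le_sub_right (min_le_right _ _) _
    have hsub : J ∩ Set.uIoc (g θ) θ ⊆ Set.Ioc θ (θ + A) := by
      rintro z ⟨hz1, hz2⟩
      rw [Set.uIoc_of_ge hθg] at hz2
      exact ⟨hz2.1, by rw [hA, add_sub_cancel]; exact le_min hz2.2 hz1.2⟩
    refine (measure_mono hsub).trans ?_
    rw [Real.volume_Ioc, add_sub_cancel_left]
    refine ENNReal.ofReal_le_ofReal (le_min ?_ ?_)
    -- First bound: everything in the window to the right of `θ` is in the tail of `S` or in `U`.
    · have h1 : Set.Ioc θ (a + μ) ⊆ (S ∩ Set.Ioi θ) ∪ U := by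
        intro z hz
        have hzJ : z ∈ J := ⟨hθ1.trans hz.1, hz.2⟩
        by_cases h : z ≤ g z
        · exact Or.inl ⟨⟨hzJ, h⟩, hz.1⟩
        · exact Or.inr ⟨hzJ, h⟩
      have h2 := (measureReal_mono h1 (hfin (Set.union_subset
        (Set.inter_subset_left.trans hSJ) hUJ))).trans (measureReal_union_le _ _)
      rw [Real.volume_real_Ioc_of_le hθ2] at h2
      linarith
    -- Second bound: `g` cannot fall faster than slope `p`, so `g z` stays above `z` for `z` up to
    -- `θ + A/(1+p)`. A long interval at `θ` thus forces a long tail of `S`.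
    · have h1 : Set.Ioc θ (θ + A / (1 + p)) ⊆ S ∩ Set.Ioi θ := by
        intro z hz
        have hz2 : (1 + p) * (z - θ) ≤ A := by
          have := hz.2
          rw [← sub_le_iff_le_add', le_div_iff₀ hp0] at this
          linarith
        have hz1 : 0 < z - θ := sub_pos.2 hz.1
        refine ⟨⟨⟨hθ1.trans hz.1, by nlinarith⟩, ?_⟩, hz.1⟩
        have := hgp θ z hz.1.le
        show z ≤ g z
        linarith
      have h2 := measureReal_mono (μ := volume) h1 (hfin (Set.inter_subset_left.trans hSJ))
      rw [Real.volume_real_Ioc_of_le (by linarith [div_nonneg hA0 hp0.le]), add_sub_cancel_left,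
        div_le_iff₀ hp0] at h2
      linarith
  -- points with `g θ < θ`
  have hUb : ∀ θ ∈ U, volume (J ∩ Set.uIoc (g θ) θ) ≤
      ENNReal.ofReal (min (volume.real (U ∩ Set.Iio θ) + c)
        ((1 + p) * volume.real (U ∩ Set.Iio θ))) := by
    rintro θ ⟨⟨hθ1, hθ2⟩, hθg⟩
    have hθg : g θ < θ := not_le.1 hθg
    set A := θ - max (g θ) a with hA
    have hA0 : 0 ≤ A := sub_nonneg.2 (max_le hθg.le hθ1.le)
    have hA1 : A ≤ θ - g θ := sub_le_sub_left (le_max_left _ _) _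
    have hA2 : A ≤ θ - a := sub_le_sub_left (le_max_right _ _) _
    have hsub : J ∩ Set.uIoc (g θ) θ ⊆ Set.Ioc (θ - A) θ := by
      rintro z ⟨hz1, hz2⟩
      rw [Set.uIoc_of_le hθg.le] at hz2
      exact ⟨by rw [hA, sub_sub_cancel]; exact max_lt hz2.1 hz1.1, hz2.2⟩
    refine (measure_mono hsub).trans ?_
    rw [Real.volume_Ioc, sub_sub_cancel]
    refine ENNReal.ofReal_le_ofReal (le_min ?_ ?_)
    · have h1 : Set.Ioo a θ ⊆ (U ∩ Set.Iio θ) ∪ S := by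
        intro z hz
        have hzJ : z ∈ J := ⟨hz.1, hz.2.le.trans hθ2⟩
        by_cases h : z ≤ g z
        · exact Or.inr ⟨hzJ, h⟩
        · exact Or.inl ⟨⟨hzJ, h⟩, hz.2⟩
      have h2 := (measureReal_mono h1 (hfin (Set.union_subset
        (Set.inter_subset_left.trans hUJ) hSJ))).trans (measureReal_union_le _ _)
      rw [Real.volume_real_Ioo_of_le hθ1.le] at h2
      linarith
    · have h1 : Set.Ioo (θ - A / (1 + p)) θ ⊆ U ∩ Set.Iio θ := by
        intro z hz
        have hz2 : (1 + p) * (θ - z) < A := by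
          have := hz.1
          rw [sub_lt_comm, lt_div_iff₀ hp0] at this
          linarith
        have hz1 : 0 < θ - z := sub_pos.2 hz.2
        refine ⟨⟨⟨by nlinarith, hz.2.le.trans hθ2⟩, ?_⟩, hz.2⟩
        have := hgp z θ hz.2.le
        show ¬ z ≤ g z
        linarith
      have h2 := measureReal_mono (μ := volume) h1 (hfin (Set.inter_subset_left.trans hUJ))
      rw [Real.volume_real_Ioo_of_le (by linarith [div_nonneg hA0 hp0.le]), sub_sub_cancel,
        div_le_iff₀ hp0] at h2
      linarith
  have hc0 : 0 ≤ c := measureReal_nonneg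
  have hd0 : 0 ≤ d := measureReal_nonneg
  obtain ⟨s, t, ⟨hs0, hsc⟩, ⟨ht0, htd⟩, hst⟩ := exists_break_points hc0 hd0 hp
  -- The bound depends on `θ` only through the tail measure of `S`, so the integral reduces to one
  -- over `(0, c]`, whatever the shape of `S`.
  have hIS : ∫⁻ θ in S, volume (J ∩ Set.uIoc (g θ) θ) ≤
      ENNReal.ofReal ((1 + p) * s ^ 2 / 2 + ((c ^ 2 - s ^ 2) / 2 + d * (c - s))) := by
    refine (setLIntegral_mono' hSm hSb).trans ?_
    rw [setLIntegral_comp_measureReal_Ioi (by linarith) hSJ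
      (ψ := fun x => ENNReal.ofReal (min (x + d) ((1 + p) * x))) (by fun_prop)]
    exact lintegral_min_affine_le hd0 (by linarith) hs0 hsc
  have hIU : ∫⁻ θ in U, volume (J ∩ Set.uIoc (g θ) θ) ≤
      ENNReal.ofReal ((1 + p) * t ^ 2 / 2 + ((d ^ 2 - t ^ 2) / 2 + c * (d - t))) := by
    refine (setLIntegral_mono' hUm hUb).trans ?_
    rw [setLIntegral_comp_measureReal_Iio (by linarith) hUJ
      (ψ := fun x => ENNReal.ofReal (min (x + c) ((1 + p) * x))) (by fun_prop)]
    exact lintegral_min_affine_le hc0 (by linarith) ht0 htd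
  have hpos : ∀ {c d s : ℝ}, 0 ≤ d → 0 ≤ s → s ≤ c →
      0 ≤ (1 + p) * s ^ 2 / 2 + ((c ^ 2 - s ^ 2) / 2 + d * (c - s)) := by
    intro c d s h1 h2 h3
    have : 0 ≤ (1 + p) * s ^ 2 / 2 := by positivity
    nlinarith [mul_nonneg h1 (sub_nonneg.2 h3),
      mul_nonneg (sub_nonneg.2 h3) (by linarith : 0 ≤ c + s)]
  rw [← lintegral_inter_add_sdiff _ J hm]
  refine (add_le_add hIS hIU).trans ?_
  rw [← ENNReal.ofReal_add (hpos hd0 hs0 hsc) (hpos hc0 ht0 htd)]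
  exact ENNReal.ofReal_le_ofReal (by rwa [hcd] at hst)

/-! ### Norm bounds for the delay operator. -/

/-- The kernel of the averaging operator over the intervals between `g t` and `t`. -/
noncomputable def delayKernel (g : ℝ → ℝ) (t s : ℝ) : ℝ≥0∞ := (Set.uIoc (g t) t).indicator 1 s

theorem measurable_delayKernel {g : ℝ → ℝ} (hg : Measurable g) :
    Measurable (Function.uncurry (delayKernel g)) := by
  have hD : MeasurableSet {q : ℝ × ℝ | min (g q.1) q.1 < q.2 ∧ q.2 ≤ max (g q.1) q.1} := by
    have h1 : MeasurableSet {q : ℝ × ℝ | min (g q.1) q.1 < q.2} :=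
      measurableSet_lt (by fun_prop) (by fun_prop)
    have h2 : MeasurableSet {q : ℝ × ℝ | q.2 ≤ max (g q.1) q.1} :=
      measurableSet_le (by fun_prop) (by fun_prop)
    exact h1.inter h2
  exact (measurable_one (α := ℝ≥0∞)).indicator hD

theorem lintegral_delayKernel_mul (g : ℝ → ℝ) (t : ℝ) (f : ℝ → ℝ≥0∞) :
    ∫⁻ s, delayKernel g t s * f s = ∫⁻ s in Set.uIoc (g t) t, f s := by
  rw [← lintegral_indicator measurableSet_uIoc]
  refine lintegral_congr fun s => ?_
  by_cases h : s ∈ Set.uIoc (g t) t <;> simp [delayKernel, h]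

theorem lintegral_delayKernel (g : ℝ → ℝ) (t : ℝ) :
    ∫⁻ s, delayKernel g t s = ENNReal.ofReal |t - g t| := by
  have := lintegral_delayKernel_mul g t 1
  simpa [Real.volume_uIoc] using this

theorem lintegral_delayKernel_mul_self (g : ℝ → ℝ) (t t' : ℝ) :
    ∫⁻ s, delayKernel g t s * delayKernel g t' s =
      volume (Set.uIoc (g t) t ∩ Set.uIoc (g t') t') := by
  rw [lintegral_delayKernel_mul]
  simp only [delayKernel]
  rw [lintegral_indicator measurableSet_uIoc, Pi.one_def, setLIntegral_one,
    Measure.restrict_apply measurableSet_uIoc, Set.inter_comm]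

theorem lintegral_sq_delay_le_of_col {g : ℝ → ℝ} (hg : Measurable g) {C : ℝ≥0∞}
    (hC : ∀ s, ∫⁻ t, delayKernel g t s * ENNReal.ofReal |t - g t| ≤ C)
    {w : ℝ → ℝ≥0∞} (hw : Measurable w) :
    ∫⁻ t, (∫⁻ s in Set.uIoc (g t) t, w s) ^ 2 ≤ C * ∫⁻ s, w s ^ 2 := by
  have := schur_col (measurable_delayKernel hg) (C := C)
    (by simpa only [lintegral_delayKernel] using hC) hw
  simpa only [lintegral_delayKernel_mul] using this

theorem delayKernel_eq_zero {g : ℝ → ℝ} {μ t s : ℝ} (hgμ : |t - g t| ≤ μ)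
    (h : s ∉ Set.Icc (t - μ) (t + μ)) : delayKernel g t s = 0 := by
  rw [delayKernel, Set.indicator_of_notMem]
  intro h2
  apply h
  rw [abs_le] at hgμ
  rw [Set.mem_uIoc] at h2
  constructor <;> rcases h2 with h2 | h2 <;> linarith [h2.1, h2.2]

/-- Intervals containing `s` belong to times within `μ` of `s` and have length at most `μ`. The
constant is not sharp; the bound supplies the finiteness needed by `schur_row` and settles `μ = 0`.
-/
theorem lintegral_sq_delay_le_crude {g : ℝ → ℝ} (hg : Measurable g) {μ : ℝ}
    (hgμ : ∀ t, |t - g t| ≤ μ) {w : ℝ → ℝ≥0∞} (hw : Measurable w) :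
    ∫⁻ t, (∫⁻ s in Set.uIoc (g t) t, w s) ^ 2 ≤
      ENNReal.ofReal μ * ENNReal.ofReal (2 * μ) * ∫⁻ s, w s ^ 2 := by
  refine lintegral_sq_delay_le_of_col hg (fun s => ?_) hw
  calc _ ≤ ∫⁻ t, (Set.Icc (s - μ) (s + μ)).indicator (fun _ => ENNReal.ofReal μ) t := by
        refine lintegral_mono fun t => ?_
        dsimp only
        by_cases h : t ∈ Set.Icc (s - μ) (s + μ)
        · rw [Set.indicator_of_mem h]
          have h1 : delayKernel g t s ≤ 1 := Set.indicator_le_self _ _ _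
          exact (mul_le_mul' h1 (ENNReal.ofReal_le_ofReal (hgμ t))).trans (by rw [one_mul])
        · rw [delayKernel_eq_zero (hgμ t), zero_mul]; · exact zero_le
          exact fun h2 => h ⟨by linarith [h2.2], by linarith [h2.1]⟩
    _ = _ := by
        rw [lintegral_indicator measurableSet_Icc, setLIntegral_const, Real.volume_Icc]
        congr 2; ring

/-- This is the Schur test for `KK*`. An interval between `g t` and `t` fits into some window `(a, a
+ μ]`, and only times within `μ` of that window matter. The two outer pieces contribute `μ²/2` each,
so only times inside the window are left to the hypothesis `hM`. -/
theorem lintegral_sq_delay_le_of_overlap {g : ℝ → ℝ} (hg : Measurable g) {μ M : ℝ}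
    (hgμ : ∀ t, |t - g t| ≤ μ) (hM0 : 0 ≤ M)
    (hM : ∀ a, ∫⁻ θ in Set.Ioc a (a + μ), volume (Set.Ioc a (a + μ) ∩ Set.uIoc (g θ) θ) ≤
      ENNReal.ofReal M)
    {w : ℝ → ℝ≥0∞} (hw : Measurable w) :
    ∫⁻ t, (∫⁻ s in Set.uIoc (g t) t, w s) ^ 2 ≤
      ENNReal.ofReal (μ ^ 2 + M) * ∫⁻ s, w s ^ 2 := by
  have hμ : 0 ≤ μ := (abs_nonneg _).trans (hgμ 0)
  have hpos : 0 ≤ μ ^ 2 + M := by positivity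
  by_cases hwfin : ∫⁻ s, w s ^ 2 = ∞
  · rcases hpos.eq_or_lt with h0 | h0
    · have hμ0 : μ = 0 := by nlinarith
      have := lintegral_sq_delay_le_crude hg hgμ hw
      rw [hμ0] at this
      simp only [ENNReal.ofReal_zero, zero_mul] at this
      exact this.trans zero_le
    · rw [hwfin, ENNReal.mul_top (by simpa using h0)]; exact le_top
  have hrow : ∀ t, ∫⁻ t', volume (Set.uIoc (g t) t ∩ Set.uIoc (g t') t') ≤
      ENNReal.ofReal (μ ^ 2 + M) := by
    intro t
    have hgt := abs_le.1 (hgμ t)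
    obtain ⟨a, ha⟩ : ∃ a, Set.uIoc (g t) t ⊆ Set.Ioc a (a + μ) := by
      rcases le_total (g t) t with h | h
      · refine ⟨t - μ, ?_⟩
        rw [Set.uIoc_of_le h]
        exact Set.Ioc_subset_Ioc (by linarith) (by linarith)
      · refine ⟨t, ?_⟩
        rw [Set.uIoc_of_ge h]
        exact Set.Ioc_subset_Ioc le_rfl (by linarith)
    set f : ℝ → ℝ≥0∞ := fun θ => volume (Set.Ioc a (a + μ) ∩ Set.uIoc (g θ) θ) with hf
    have hz : ∀ {θ z : ℝ}, z ∈ Set.uIoc (g θ) θ → z ≤ θ + μ ∧ θ - μ < z := by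
      intro θ z hz
      have := abs_le.1 (hgμ θ)
      rw [Set.mem_uIoc] at hz
      rcases hz with hz | hz <;> constructor <;> linarith [hz.1, hz.2]
    -- A time `θ ≤ a` reaches at most up to `θ + μ`, so the overlap is at most `θ + μ - a`: the area
    -- of a triangle.
    have h1 : ∫⁻ θ in Set.Ioc (a - μ) a, f θ ≤ ENNReal.ofReal (μ ^ 2 / 2) := by
      have := lintegral_Ioc_le_affine (a := a - μ) (b := a) (m := 1) (c := μ - a) (by linarith)
        (f := f) (fun θ _ => ?_) (fun θ hθ => by linarith [hθ.1])
      · refine this.trans (ENNReal.ofReal_le_ofReal (le_of_eq (by ring)))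
      · refine (measure_mono (t := Set.Ioc a (θ + μ)) ?_).trans ?_
        · rintro z ⟨hz1, hz2⟩; exact ⟨hz1.1, (hz hz2).1⟩
        · rw [Real.volume_Ioc]
          exact ENNReal.ofReal_le_ofReal (le_of_eq (by ring))
    have h3 : ∫⁻ θ in Set.Ioc (a + μ) (a + 2 * μ), f θ ≤ ENNReal.ofReal (μ ^ 2 / 2) := by
      have := lintegral_Ioc_le_affine (a := a + μ) (b := a + 2 * μ) (m := -1) (c := a + 2 * μ)
        (by linarith)
        (f := f) (fun θ _ => ?_) (fun θ hθ => by linarith [hθ.2])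
      · refine this.trans (ENNReal.ofReal_le_ofReal (le_of_eq (by ring)))
      · refine (measure_mono (t := Set.Ioc (θ - μ) (a + μ)) ?_).trans ?_
        · rintro z ⟨hz1, hz2⟩; exact ⟨(hz hz2).2, hz1.2⟩
        · rw [Real.volume_Ioc]
          exact ENNReal.ofReal_le_ofReal (le_of_eq (by ring))
    calc _ ≤ ∫⁻ θ, (Set.Ioc (a - μ) (a + 2 * μ)).indicator f θ := by
          refine lintegral_mono fun θ => ?_
          dsimp only
          by_cases h : θ ∈ Set.Ioc (a - μ) (a + 2 * μ)
          · rw [Set.indicator_of_mem h]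
            exact measure_mono (Set.inter_subset_inter_left _ ha)
          · rw [show Set.uIoc (g t) t ∩ Set.uIoc (g θ) θ = ∅ from ?_]
            · simp
            · ext z
              simp only [Set.mem_inter_iff, Set.mem_empty_iff_false, iff_false, not_and]
              intro hz1 hz2
              apply h
              constructor <;> linarith [(hz hz2).1, (hz hz2).2, (ha hz1).1, (ha hz1).2]
      _ = (∫⁻ θ in Set.Ioc (a - μ) a, f θ) + ((∫⁻ θ in Set.Ioc a (a + μ), f θ)
            + ∫⁻ θ in Set.Ioc (a + μ) (a + 2 * μ), f θ) := by
          rw [lintegral_indicator measurableSet_Ioc,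
            lintegral_Ioc_split (b := a) (by linarith) (by linarith),
            lintegral_Ioc_split (a := a) (b := a + μ) (by linarith) (by linarith)]
      _ ≤ ENNReal.ofReal (μ ^ 2 / 2) + (ENNReal.ofReal M + ENNReal.ofReal (μ ^ 2 / 2)) :=
          add_le_add h1 (add_le_add (hM a) h3)
      _ = _ := by
          rw [← ENNReal.ofReal_add hM0 (by positivity), ← ENNReal.ofReal_add (by positivity)
            (by positivity)]
          congr 1; ring
  have := schur_row (measurable_delayKernel hg) (C := ENNReal.ofReal (μ ^ 2 + M))
    (by simpa only [lintegral_delayKernel_mul_self] using hrow) hw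
    (by
      simp only [lintegral_delayKernel_mul]
      refine ((lintegral_sq_delay_le_crude hg hgμ hw).trans_lt ?_).ne
      exact ENNReal.mul_lt_top (ENNReal.mul_lt_top ENNReal.ofReal_lt_top ENNReal.ofReal_lt_top) (lt_top_iff_ne_top.2 hwfin))
  simpa only [lintegral_delayKernel_mul] using this

/-- The bound `7/4` for arbitrary measurable delays. -/
theorem lintegral_sq_delay_le_top {g : ℝ → ℝ} (hg : Measurable g) {μ : ℝ}
    (hgμ : ∀ t, |t - g t| ≤ μ) {w : ℝ → ℝ≥0∞} (hw : Measurable w) :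
    ∫⁻ t, (∫⁻ s in Set.uIoc (g t) t, w s) ^ 2 ≤
      ENNReal.ofReal (7 / 4 * μ ^ 2) * ∫⁻ s, w s ^ 2 := by
  have hμ : 0 ≤ μ := (abs_nonneg _).trans (hgμ 0)
  have := lintegral_sq_delay_le_of_overlap hg hgμ (M := 3 / 4 * μ ^ 2) (by positivity)
    (fun a => ?_) hw
  · convert this using 3; ring
  -- The interval leaves `θ` on one side only, so the overlap is at most the distance to the farther
  -- end of the window. This integrates to `3μ²/4`.
  have hb : ∀ θ ∈ Set.Ioc a (a + μ), volume (Set.Ioc a (a + μ) ∩ Set.uIoc (g θ) θ) ≤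
      ENNReal.ofReal (max (θ - a) (a + μ - θ)) := by
    intro θ hθ
    rcases le_total (g θ) θ with h | h
    · refine (measure_mono (t := Set.Ioc a θ) ?_).trans ?_
      · rintro z ⟨hz1, hz2⟩
        rw [Set.uIoc_of_le h] at hz2
        exact ⟨hz1.1, hz2.2⟩
      · rw [Real.volume_Ioc]; exact ENNReal.ofReal_le_ofReal (le_max_left _ _)
    · refine (measure_mono (t := Set.Ioc θ (a + μ)) ?_).trans ?_
      · rintro z ⟨hz1, hz2⟩
        rw [Set.uIoc_of_ge h] at hz2
        exact ⟨hz2.1, hz1.2⟩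
      · rw [Real.volume_Ioc]; exact ENNReal.ofReal_le_ofReal (le_max_right _ _)
  rw [lintegral_Ioc_split (b := a + μ / 2) (by linarith) (by linarith)]
  refine (add_le_add
    (lintegral_Ioc_le_affine (m := -1) (c := a + μ) (by linarith) (fun θ hθ => ?_)
      (fun θ hθ => by linarith [hθ.2]))
    (lintegral_Ioc_le_affine (m := 1) (c := -a) (by linarith) (fun θ hθ => ?_)
      (fun θ hθ => by linarith [hθ.1]))).trans ?_
  · refine (hb θ ⟨hθ.1, by linarith [hθ.2]⟩).trans (ENNReal.ofReal_le_ofReal ?_)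
    exact max_le (by linarith [hθ.2]) (by linarith)
  · refine (hb θ ⟨by linarith [hθ.1], hθ.2⟩).trans (ENNReal.ofReal_le_ofReal ?_)
    exact max_le (by linarith) (by linarith [hθ.1])
  · rw [← ENNReal.ofReal_add (by nlinarith) (by nlinarith)]
    exact ENNReal.ofReal_le_ofReal (le_of_eq (by ring))

/-- The bound `(7 p - 1) / (4 p)`, `p ≥ 1`, for delays with increments of slope at most `1 + p`. -/
theorem lintegral_sq_delay_le_of_one_le {g : ℝ → ℝ} (hg : Measurable g) {μ p : ℝ}
    (hgμ : ∀ t, |t - g t| ≤ μ) (hp : 1 ≤ p) (hgp : ∀ s t, s ≤ t → g s - g t ≤ p * (t - s))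
    {w : ℝ → ℝ≥0∞} (hw : Measurable w) :
    ∫⁻ t, (∫⁻ s in Set.uIoc (g t) t, w s) ^ 2 ≤
      ENNReal.ofReal ((7 * p - 1) / (4 * p) * μ ^ 2) * ∫⁻ s, w s ^ 2 := by
  have hμ : 0 ≤ μ := (abs_nonneg _).trans (hgμ 0)
  have hM : 0 ≤ 3 / 4 - 1 / (4 * p) := by
    rw [sub_nonneg, div_le_iff₀ (by linarith)]; linarith
  have := lintegral_sq_delay_le_of_overlap hg hgμ (M := (3 / 4 - 1 / (4 * p)) * μ ^ 2)
    (by positivity) (fun a => lintegral_overlap_le hg hp hμ hgp) hw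
  convert this using 3
  field_simp; ring

/-- By symmetry take `α ≥ 0`. The two clipped ramps are shifted in opposite directions, and the case
`α = 0` attains the bound; the explicit areas show that a shift never increases the sum. The cases
differ in whether the delayed ramp reaches height `μ` before `x = μ`. -/
theorem lintegral_clip_add_le {k μ α : ℝ} (hk : 1 ≤ k) (hμ : 0 ≤ μ) (h1 : -μ ≤ α) (h2 : α ≤ μ) :
    (∫⁻ x in Set.Ioc 0 μ, ENNReal.ofReal (min μ (k * x + α))) +
      (∫⁻ x in Set.Ioc 0 μ, ENNReal.ofReal (min μ (k * x - α))) ≤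
      ENNReal.ofReal ((2 - 1 / k) * μ ^ 2) := by
  have hk0 : 0 < k := by linarith
  wlog hα : 0 ≤ α generalizing α
  · have := this (α := -α) (by linarith) (by linarith) (by linarith)
    rw [add_comm]
    simpa only [sub_neg_eq_add, ← sub_eq_add_neg] using this
  have hs1 : 0 ≤ (μ - α) / k := div_nonneg (by linarith) hk0.le
  have hs1' : (μ - α) / k ≤ μ := by rw [div_le_iff₀ hk0]; nlinarith
  have hA : ∫⁻ x in Set.Ioc 0 μ, ENNReal.ofReal (min μ (k * x + α)) ≤
      ENNReal.ofReal (μ ^ 2 - (μ - α) ^ 2 / (2 * k)) := by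
    rw [lintegral_Ioc_split hs1 hs1']
    refine (add_le_add
      (lintegral_Ioc_le_affine (m := k) (c := α) hs1
        (fun x _ => ENNReal.ofReal_le_ofReal (min_le_right _ _))
        (fun x hx => by have := mul_pos hk0 hx.1; linarith))
      (lintegral_Ioc_le_affine (m := 0) (c := μ) hs1'
        (fun x _ => ENNReal.ofReal_le_ofReal (by rw [zero_mul, zero_add]; exact min_le_left _ _))
        (fun x _ => by linarith))).trans ?_
    have e1 : 0 ≤ k * (((μ - α) / k) ^ 2 - 0 ^ 2) / 2 + α * ((μ - α) / k - 0) := by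
      rw [sub_zero, zero_pow two_ne_zero, sub_zero]; positivity
    rw [← ENNReal.ofReal_add e1 (by nlinarith [mul_nonneg hμ (sub_nonneg.2 hs1')])]
    refine ENNReal.ofReal_le_ofReal (le_of_eq ?_)
    field_simp; ring
  have hαk : 0 ≤ α / k := by positivity
  have hαk' : α / k ≤ μ := by rw [div_le_iff₀ hk0]; nlinarith
  have hB0 : ∫⁻ x in Set.Ioc 0 (α / k), ENNReal.ofReal (min μ (k * x - α)) = 0 := by
    rw [setLIntegral_eq_zero_iff measurableSet_Ioc (by fun_prop)]
    refine Eventually.of_forall fun x hx => ENNReal.ofReal_eq_zero.2 ((min_le_right _ _).trans ?_)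
    have := (le_div_iff₀ hk0).1 hx.2
    linarith
  have hkx : ∀ {x : ℝ}, α / k < x → 0 ≤ k * x + -α := fun {x} hx => by
    have := (div_lt_iff₀ hk0).1 hx
    linarith
  rw [lintegral_Ioc_split (a := 0) hαk hαk' (fun x => ENNReal.ofReal (min μ (k * x - α))), hB0,
    zero_add]
  have hApos : 0 ≤ μ ^ 2 - (μ - α) ^ 2 / (2 * k) := by
    rw [sub_nonneg, div_le_iff₀ (by positivity)]
    nlinarith [mul_nonneg hμ hα, sq_nonneg α]
  by_cases hc : α + μ ≤ k * μ
  · have hs3 : α / k ≤ (α + μ) / k := by gcongr; linarith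
    have hs3' : (α + μ) / k ≤ μ := by rw [div_le_iff₀ hk0]; linarith
    have hB : ∫⁻ x in Set.Ioc (α / k) μ, ENNReal.ofReal (min μ (k * x - α)) ≤
        ENNReal.ofReal (μ ^ 2 - α * μ / k - μ ^ 2 / (2 * k)) := by
      rw [lintegral_Ioc_split hs3 hs3']
      refine (add_le_add
        (lintegral_Ioc_le_affine (m := k) (c := -α) hs3
          (fun x _ => ENNReal.ofReal_le_ofReal (min_le_right _ _))
          (fun x hx => hkx hx.1))
        (lintegral_Ioc_le_affine (m := 0) (c := μ) hs3'
          (fun x _ => ENNReal.ofReal_le_ofReal (by rw [zero_mul, zero_add]; exact min_le_left _ _))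
          (fun x _ => by linarith))).trans ?_
      have e1 : k * (((α + μ) / k) ^ 2 - (α / k) ^ 2) / 2 + -α * ((α + μ) / k - α / k) =
          μ ^ 2 / (2 * k) := by
        field_simp; ring
      rw [e1, ← ENNReal.ofReal_add (by positivity) (by nlinarith [mul_nonneg hμ (sub_nonneg.2 hs3')])]
      refine ENNReal.ofReal_le_ofReal (le_of_eq ?_)
      field_simp; ring
    refine (add_le_add hA hB).trans ?_
    have e2 : (2 - 1 / k) * μ ^ 2 -
        (μ ^ 2 - (μ - α) ^ 2 / (2 * k) + (μ ^ 2 - α * μ / k - μ ^ 2 / (2 * k))) =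
        α ^ 2 / (2 * k) := by
      field_simp; ring
    have e3 : 0 ≤ μ ^ 2 - α * μ / k - μ ^ 2 / (2 * k) := by
      have : μ ^ 2 - α * μ / k - μ ^ 2 / (2 * k) = μ * (2 * (k * μ - (α + μ)) + μ) / (2 * k) := by
        field_simp; ring
      rw [this]
      refine div_nonneg (mul_nonneg hμ (by linarith)) (by positivity)
    rw [← ENNReal.ofReal_add hApos e3]
    refine ENNReal.ofReal_le_ofReal ?_
    have : 0 ≤ α ^ 2 / (2 * k) := by positivity
    linarith
  · push Not at hc
    have hB := lintegral_Ioc_le_affine (m := k) (c := -α) hαk'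
      (f := fun x => ENNReal.ofReal (min μ (k * x - α)))
      (fun x _ => ENNReal.ofReal_le_ofReal (min_le_right _ _)) (fun x hx => hkx hx.1)
    have e1 : k * (μ ^ 2 - (α / k) ^ 2) / 2 + -α * (μ - α / k) = (k * μ - α) ^ 2 / (2 * k) := by
      field_simp; ring
    rw [e1] at hB
    refine (add_le_add hA hB).trans ?_
    rw [← ENNReal.ofReal_add hApos (by positivity)]
    refine ENNReal.ofReal_le_ofReal ?_
    have e2 : (2 - 1 / k) * μ ^ 2 - (μ ^ 2 - (μ - α) ^ 2 / (2 * k) + (k * μ - α) ^ 2 / (2 * k)) =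
        (k - 1) * μ * ((2 * (α + μ - k * μ)) + (k - 1) * μ) / (2 * k) := by
      field_simp; ring
    have : 0 ≤ (k - 1) * μ * ((2 * (α + μ - k * μ)) + (k - 1) * μ) / (2 * k) := by
      have : 0 ≤ (k - 1) * μ := mul_nonneg (by linarith) hμ
      refine div_nonneg (mul_nonneg this (by linarith)) (by positivity)
    linarith

/-- The bound `(2 p + 1) / (p + 1)`, `p ≥ 0`, for delays with increments of slope at most `1 + p`. -/
theorem lintegral_sq_delay_le_of_nonneg {g : ℝ → ℝ} (hg : Measurable g) {μ p : ℝ}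
    (hgμ : ∀ t, |t - g t| ≤ μ) (hp : 0 ≤ p) (hgp : ∀ s t, s ≤ t → g s - g t ≤ p * (t - s))
    {w : ℝ → ℝ≥0∞} (hw : Measurable w) :
    ∫⁻ t, (∫⁻ s in Set.uIoc (g t) t, w s) ^ 2 ≤
      ENNReal.ofReal ((2 * p + 1) / (p + 1) * μ ^ 2) * ∫⁻ s, w s ^ 2 := by
  have hμ : 0 ≤ μ := (abs_nonneg _).trans (hgμ 0)
  refine lintegral_sq_delay_le_of_col hg (fun s => ?_) hw
  set k := 1 + p with hk
  have hk1 : 1 ≤ k := by linarith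
  -- If `t' < s ≤ g t'` and `g t < s ≤ t`, the slope condition gives `(g t' - t') + (t - g t) ≤ k(s
  -- - t') + k(t - s)`. Hence one number `α` separates the excesses on the two sides of `s`; the
  -- supremum works. Inserting `-μ` keeps the set nonempty and `α ≥ -μ`.
  obtain ⟨α, hα1, hα2, hX, hY⟩ : ∃ α, -μ ≤ α ∧ α ≤ μ ∧
      (∀ t, t < s → s ≤ g t → g t - t ≤ k * (s - t) + α) ∧
      (∀ t, s ≤ t → g t < s → t - g t ≤ k * (t - s) - α) := by
    set Z := insert (-μ) ((fun t => g t - t - k * (s - t)) '' {t | t < s ∧ s ≤ g t}) with hZ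
    have hub : ∀ z ∈ Z, z ≤ μ := by
      rintro z (rfl | ⟨t, ⟨h1, h2⟩, rfl⟩)
      · linarith
      · have := (abs_le.1 (hgμ t)).1
        have : 0 ≤ k * (s - t) := mul_nonneg (by linarith) (by linarith)
        dsimp only; linarith
    have hne : Z.Nonempty := ⟨-μ, Or.inl rfl⟩
    refine ⟨sSup Z, le_csSup ⟨μ, hub⟩ (Or.inl rfl), csSup_le hne hub, ?_, ?_⟩
    · intro t h1 h2
      have : g t - t - k * (s - t) ≤ sSup Z := le_csSup ⟨μ, hub⟩ (Or.inr ⟨t, ⟨h1, h2⟩, rfl⟩)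
      linarith
    · intro t h1 h2
      have : sSup Z ≤ k * (t - s) - (t - g t) := by
        refine csSup_le hne ?_
        rintro z (rfl | ⟨t', ⟨h3, h4⟩, rfl⟩)
        · have := (abs_le.1 (hgμ t)).2
          have : 0 ≤ k * (t - s) := mul_nonneg (by linarith) (by linarith)
          linarith
        · have := hgp t' t (h3.le.trans h1)
          rw [hk]; dsimp only; linarith
      linarith
  set φ : ℝ → ℝ≥0∞ := (Set.Ioc 0 μ).indicator fun x => ENNReal.ofReal (min μ (k * x + α)) with hφ
  set ψ : ℝ → ℝ≥0∞ := (Set.Ioc 0 μ).indicator fun x => ENNReal.ofReal (min μ (k * x - α)) with hψ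
  have hφm : Measurable φ := Measurable.indicator (by fun_prop) measurableSet_Ioc
  have hψm : Measurable ψ := Measurable.indicator (by fun_prop) measurableSet_Ioc
  calc _ ≤ ∫⁻ t, (φ (s - t) + ψ (t - s)) := by
        refine lintegral_mono_ae ?_
        filter_upwards [Measure.ae_ne volume s] with t hts
        have hgt := abs_le.1 (hgμ t)
        by_cases h : s ∈ Set.uIoc (g t) t
        · rw [delayKernel, Set.indicator_of_mem h, Pi.one_apply, one_mul]
          rw [Set.mem_uIoc] at h
          rcases h with ⟨h1, h2⟩ | ⟨h1, h2⟩
          · have h3 : t - s ∈ Set.Ioc 0 μ :=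
              ⟨sub_pos.2 (lt_of_le_of_ne h2 hts.symm), by linarith⟩
            refine le_add_left ?_
            rw [hψ, Set.indicator_of_mem h3]
            refine ENNReal.ofReal_le_ofReal (le_min (hgμ t) ?_)
            rw [abs_of_nonneg (by linarith)]
            exact hY t h2 h1
          · have h3 : s - t ∈ Set.Ioc 0 μ := ⟨sub_pos.2 h1, by linarith⟩
            refine le_add_right ?_
            rw [hφ, Set.indicator_of_mem h3]
            refine ENNReal.ofReal_le_ofReal (le_min (hgμ t) ?_)
            rw [abs_of_nonpos (by linarith), neg_sub]
            exact hX t h1 h2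
        · rw [delayKernel, Set.indicator_of_notMem h, zero_mul]; exact zero_le
    _ = (∫⁻ x, φ x) + ∫⁻ x, ψ x := by
        rw [lintegral_add_left (by fun_prop), lintegral_sub_left_eq_self,
          lintegral_sub_right_eq_self]
    _ ≤ ENNReal.ofReal ((2 - 1 / k) * μ ^ 2) := by
        rw [hφ, hψ, lintegral_indicator measurableSet_Ioc, lintegral_indicator measurableSet_Ioc]
        exact lintegral_clip_add_le hk1 hμ hα1 hα2
    _ = _ := by
        congr 2
        rw [hk]
        field_simp; ring

/-! ### The quadratic form of the linear matrix inequality. -/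

section
open Matrix

theorem dotProduct_transpose_mulVec_comm {k l : Type*} [Fintype k] [Fintype l] (M : Matrix k l ℝ)
    (a : l → ℝ) (b : k → ℝ) : a ⬝ᵥ Mᵀ *ᵥ b = b ⬝ᵥ M *ᵥ a := by
  rw [dotProduct_mulVec, vecMul_transpose, dotProduct_comm]

namespace DelayLMI

theorem symBlocks_form {k l : Type*} [Fintype k] [Fintype l] (A : Matrix k k ℝ) (B : Matrix k l ℝ)
    (D : Matrix l l ℝ) (a : k → ℝ) (b : l → ℝ) :
    Sum.elim a b ⬝ᵥ symBlocks A B D *ᵥ Sum.elim a b =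
      a ⬝ᵥ A *ᵥ a + 2 * (a ⬝ᵥ B *ᵥ b) + b ⬝ᵥ D *ᵥ b := by
  rw [symBlocks, fromBlocks_mulVec]
  simp only [Sum.elim_comp_inl, Sum.elim_comp_inr, sumElim_dotProduct_sumElim, dotProduct_add,
    dotProduct_transpose_mulVec_comm]
  ring

variable {n : ℕ}

theorem matPsi_form (A₀ : Matrix (Fin n) (Fin n) ℝ) (h : ℝ)
    (P₁ P₂ P₃ Y₁ Y₂ S R : Matrix (Fin n) (Fin n) ℝ) (x y : Fin n → ℝ) :
    Sum.elim x y ⬝ᵥ matPsi A₀ h (matP P₁ P₂ P₃) (matY Y₁ Y₂) S R *ᵥ Sum.elim x y =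
      2 * (y ⬝ᵥ P₁ *ᵥ x) + 2 * ((P₂ *ᵥ x + P₃ *ᵥ y) ⬝ᵥ (A₀ *ᵥ x - y))
        + x ⬝ᵥ S *ᵥ x + h * (y ⬝ᵥ R *ᵥ y) + 2 * (x ⬝ᵥ (Y₁ *ᵥ x + Y₂ *ᵥ y)) := by
  simp only [matPsi, matP, matY, add_mulVec, dotProduct_add, fromBlocks_transpose,
    fromBlocks_multiply, fromBlocks_mulVec, fromRows_mulVec, fromCols_mulVec,
    dotProduct_transpose_mulVec_comm, Sum.elim_comp_inl, Sum.elim_comp_inr,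
    sumElim_dotProduct_sumElim, ← mulVec_mulVec, zero_mulVec, smul_mulVec, transpose_zero,
    dotProduct_smul, smul_eq_mul, dotProduct_zero, add_zero, zero_add, mul_one, one_mul,
    neg_mulVec, mul_neg, neg_mul, zero_mul, mul_zero, dotProduct_neg, dotProduct_sub,
    add_dotProduct]
  rw [dotProduct_comm (P₂ *ᵥ x) y, dotProduct_comm (P₃ *ᵥ y) y,
    dotProduct_comm (A₀ *ᵥ x) (P₂ *ᵥ x), dotProduct_comm (A₀ *ᵥ x) (P₃ *ᵥ y)]
  ring

/-- `matGamma` with the product of rectangular matrices written as `Matrix` multiplication. -/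
theorem matGamma_eq (A₀ A₁ : Matrix (Fin n) (Fin n) ℝ) (h : ℝ)
    (P : Matrix (Fin n ⊕ Fin n) (Fin n ⊕ Fin n) ℝ) (Y : Matrix (Fin n) (Fin n ⊕ Fin n) ℝ)
    (S T R : Matrix (Fin n) (Fin n) ℝ) :
    matGamma A₀ A₁ h P Y S T R = symBlocks
      (symBlocks (matPsi A₀ h P Y S R)
        (Matrix.instHMulOfFintypeOfMulOfAddCommMonoid.hMul P.transpose (Matrix.fromRows 0 A₁)
          - Y.transpose + Matrix.fromRows T 0)
        (-S - T - T.transpose))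
      (Matrix.fromRows (h • Y.transpose) (h • T.transpose))
      (-(h • R)) := rfl

theorem matGamma_form (A₀ A₁ : Matrix (Fin n) (Fin n) ℝ) (h : ℝ)
    (P₁ P₂ P₃ Y₁ Y₂ S T R : Matrix (Fin n) (Fin n) ℝ) (x y ζ z : Fin n → ℝ) :
    Sum.elim (Sum.elim (Sum.elim x y) ζ) z ⬝ᵥ
        matGamma A₀ A₁ h (matP P₁ P₂ P₃) (matY Y₁ Y₂) S T R *ᵥ
        Sum.elim (Sum.elim (Sum.elim x y) ζ) z =
      2 * (y ⬝ᵥ P₁ *ᵥ x) + 2 * ((P₂ *ᵥ x + P₃ *ᵥ y) ⬝ᵥ (A₀ *ᵥ x + A₁ *ᵥ ζ - y))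
        + x ⬝ᵥ S *ᵥ x - ζ ⬝ᵥ S *ᵥ ζ + h * (y ⬝ᵥ R *ᵥ y) - h * (z ⬝ᵥ R *ᵥ z)
        + 2 * ((x - ζ + h • z) ⬝ᵥ (Y₁ *ᵥ x + Y₂ *ᵥ y + T *ᵥ ζ)) := by
  rw [matGamma_eq, symBlocks_form, symBlocks_form, matPsi_form]
  simp only [matP, matY, add_mulVec, sub_mulVec, dotProduct_add, fromBlocks_transpose,
    fromBlocks_mulVec, fromRows_mulVec, transpose_fromCols,
    dotProduct_transpose_mulVec_comm, Sum.elim_comp_inl, Sum.elim_comp_inr,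
    sumElim_dotProduct_sumElim, ← mulVec_mulVec, zero_mulVec, smul_mulVec, transpose_zero,
    dotProduct_smul, smul_eq_mul, dotProduct_zero, add_zero, zero_add,
    neg_mulVec, dotProduct_neg, dotProduct_sub, zero_dotProduct,
    add_dotProduct, sub_dotProduct, smul_dotProduct]
  rw [dotProduct_comm (A₁ *ᵥ ζ) (P₂ *ᵥ x), dotProduct_comm (A₁ *ᵥ ζ) (P₃ *ᵥ y)]
  ring

/-- The terms are grouped by multiplier: `P₂, P₃` multiply the residual of the system equation, and
`Y₁, Y₂, T` multiply `x - ζ + h z`. Both factors can be made zero by the choice of the vector. -/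
theorem lmiMatrix_form (A₀ A₁ : Matrix (Fin n) (Fin n) ℝ) (h μ F : ℝ)
    (P₁ P₂ P₃ S Y₁ Y₂ T R Rₐ : Matrix (Fin n) (Fin n) ℝ) (x y ζ z v w : Fin n → ℝ) :
    Sum.elim (Sum.elim (Sum.elim (Sum.elim x y) ζ) z) (Sum.elim v w) ⬝ᵥ
        lmiMatrix A₀ A₁ h μ F P₁ P₂ P₃ S Y₁ Y₂ T R Rₐ *ᵥ
        Sum.elim (Sum.elim (Sum.elim (Sum.elim x y) ζ) z) (Sum.elim v w) =
      2 * (y ⬝ᵥ P₁ *ᵥ x) + 2 * ((P₂ *ᵥ x + P₃ *ᵥ y) ⬝ᵥ (A₀ *ᵥ x + A₁ *ᵥ (ζ + μ • v) - y))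
        + x ⬝ᵥ S *ᵥ x - ζ ⬝ᵥ S *ᵥ ζ + h * (y ⬝ᵥ R *ᵥ y) - h * (z ⬝ᵥ R *ᵥ z)
        + 2 * ((x - ζ + h • z) ⬝ᵥ (Y₁ *ᵥ x + Y₂ *ᵥ y + T *ᵥ ζ))
        - μ * (v ⬝ᵥ Rₐ *ᵥ v) + μ * F * (2 * (y ⬝ᵥ Rₐ *ᵥ w) - w ⬝ᵥ Rₐ *ᵥ w) := by
  rw [lmiMatrix, symBlocks_form, symBlocks_form, matGamma_form]
  simp only [outerCol, dotProduct_add,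
    fromRows_mulVec, fromCols_mulVec_sumElim,
    dotProduct_transpose_mulVec_comm,
    sumElim_dotProduct_sumElim, ← mulVec_mulVec, zero_mulVec, smul_mulVec,
    dotProduct_smul, smul_eq_mul, dotProduct_zero, add_zero, zero_add,
    neg_mulVec, dotProduct_neg, dotProduct_sub, mulVec_add, mulVec_smul,
    add_dotProduct, sub_dotProduct, smul_dotProduct]
  rw [dotProduct_comm (A₁ *ᵥ v) (P₂ *ᵥ x), dotProduct_comm (A₁ *ᵥ v) (P₃ *ᵥ y)]
  ring

/-- The choices `z = -(x - ζ)/h` and `v = -u/μ` annihilate both multiplier terms, and `w = y` turns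
`2yᵀRₐw - wᵀRₐw` into `yᵀRₐy`. -/
theorem lmiMatrix_form_trajectory {A₀ A₁ : Matrix (Fin n) (Fin n) ℝ} {h μ F : ℝ} (hh : h ≠ 0)
    (hμ : μ ≠ 0) (P₁ P₂ P₃ S Y₁ Y₂ T R Rₐ : Matrix (Fin n) (Fin n) ℝ) {x y ζ u : Fin n → ℝ}
    (hy : y = A₀ *ᵥ x + A₁ *ᵥ (ζ - u)) :
    Sum.elim (Sum.elim (Sum.elim (Sum.elim x y) ζ) (-h⁻¹ • (x - ζ))) (Sum.elim (-μ⁻¹ • u) y) ⬝ᵥ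
        lmiMatrix A₀ A₁ h μ F P₁ P₂ P₃ S Y₁ Y₂ T R Rₐ *ᵥ
        Sum.elim (Sum.elim (Sum.elim (Sum.elim x y) ζ) (-h⁻¹ • (x - ζ))) (Sum.elim (-μ⁻¹ • u) y) =
      2 * (y ⬝ᵥ P₁ *ᵥ x) + x ⬝ᵥ S *ᵥ x - ζ ⬝ᵥ S *ᵥ ζ + h * (y ⬝ᵥ R *ᵥ y)
        - h⁻¹ * ((x - ζ) ⬝ᵥ R *ᵥ (x - ζ)) - μ⁻¹ * (u ⬝ᵥ Rₐ *ᵥ u) + μ * F * (y ⬝ᵥ Rₐ *ᵥ y) := by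
  have e1 : A₀ *ᵥ x + A₁ *ᵥ (ζ + μ • -μ⁻¹ • u) - y = 0 := by
    rw [smul_smul, mul_neg, mul_inv_cancel₀ hμ, neg_one_smul, ← sub_eq_add_neg, hy, sub_self]
  have e2 : x - ζ + h • -h⁻¹ • (x - ζ) = 0 := by
    rw [smul_smul, mul_neg, mul_inv_cancel₀ hh, neg_one_smul, add_neg_cancel]
  rw [lmiMatrix_form, e1, e2]
  simp only [dotProduct_zero, zero_dotProduct, mulVec_smul, smul_dotProduct, dotProduct_smul,
    smul_eq_mul]
  field_simp
  ring

end DelayLMI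

/-- The constant is the minimum of the form on the Euclidean unit sphere; homogeneity does the rest.
-/
theorem Matrix.PosDef.exists_le_dotProduct {ι : Type*} [Fintype ι] {M : Matrix ι ι ℝ}
    (hM : M.PosDef) : ∃ ε > 0, ∀ v, ε * (v ⬝ᵥ v) ≤ v ⬝ᵥ M *ᵥ v := by
  classical
  rcases isEmpty_or_nonempty ι with hι | hι
  · exact ⟨1, one_pos, fun v => by simp [Subsingleton.elim v 0]⟩
  have hcont : Continuous fun v : EuclideanSpace ℝ ι => v.ofLp ⬝ᵥ M *ᵥ v.ofLp := by
    simp only [dotProduct, mulVec]; fun_prop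
  obtain ⟨v₀, hv₀, hmin⟩ := (isCompact_sphere (0 : EuclideanSpace ℝ ι) 1).exists_isMinOn
    (NormedSpace.sphere_nonempty.2 zero_le_one) hcont.continuousOn
  have hne : v₀.ofLp ≠ 0 := by
    intro h0
    have : v₀ = 0 := by ext i; simp [h0]
    rw [this] at hv₀; simp at hv₀
  refine ⟨_, by simpa using hM.dotProduct_mulVec_pos hne, fun v => ?_⟩
  by_cases hv : v = 0
  · simp [hv]
  obtain ⟨V, rfl⟩ : ∃ V : EuclideanSpace ℝ ι, v = V.ofLp := ⟨WithLp.toLp 2 v, rfl⟩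
  have hV : ‖V‖ ≠ 0 := by
    rw [norm_ne_zero_iff]; rintro rfl; exact hv rfl
  have hVV : V.ofLp ⬝ᵥ V.ofLp = ‖V‖ ^ 2 := by
    rw [EuclideanSpace.real_norm_sq_eq]; simp [dotProduct, sq]
  have h1 := hmin (show ‖V‖⁻¹ • V ∈ Metric.sphere (0 : EuclideanSpace ℝ ι) 1 by
    simp [norm_smul, hV])
  simp only [Set.mem_ofPred_eq, WithLp.ofLp_smul, mulVec_smul, smul_dotProduct, dotProduct_smul,
    smul_eq_mul] at h1
  rw [hVV]
  have h2 : ‖V‖⁻¹ * (‖V‖⁻¹ * (V.ofLp ⬝ᵥ M *ᵥ V.ofLp)) * ‖V‖ ^ 2 = V.ofLp ⬝ᵥ M *ᵥ V.ofLp := by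
    field_simp
  rw [← h2]
  gcongr

end

/-! ### Absolutely continuous curves and a priori bounds for solutions. -/

theorem AbsolutelyContinuousOnInterval.lipschitzWith_comp {X Y : Type*} [PseudoMetricSpace X]
    [PseudoMetricSpace Y] {f : ℝ → X} {a b : ℝ} (hf : AbsolutelyContinuousOnInterval f a b)
    {φ : X → Y} {K : NNReal} (hφ : LipschitzWith K φ) :
    AbsolutelyContinuousOnInterval (fun t => φ (f t)) a b := by
  have h := Tendsto.const_mul (K : ℝ) hf
  rw [mul_zero] at h
  refine squeeze_zero (fun t => Finset.sum_nonneg fun i _ => dist_nonneg) (fun t => ?_) h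
  rw [Finset.mul_sum]
  exact Finset.sum_le_sum fun i _ => hφ.dist_le_mul _ _

/-- Pairing with `v = B(x b - x a)` reduces the claim to the fundamental theorem for a scalar
absolutely continuous function. This gives `‖v‖²` bounded by `‖v‖` times the integral, and one
factor cancels. -/
theorem AbsolutelyContinuousOnInterval.enorm_map_sub_le {E F : Type*} [NormedAddCommGroup E]
    [NormedSpace ℝ E] [NormedAddCommGroup F] [InnerProductSpace ℝ F] {x : ℝ → E} {a b : ℝ}
    (hab : a ≤ b) (hx : AbsolutelyContinuousOnInterval x a b)
    (hd : ∀ᵐ t, t ∈ Set.Ioc a b → DifferentiableAt ℝ x t) (B : E →L[ℝ] F) :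
    ‖B (x b - x a)‖ₑ ≤ ∫⁻ t in Set.Ioc a b, ‖B (deriv x t)‖ₑ := by
  set v := B (x b - x a) with hv
  by_cases hv0 : v = 0
  · rw [hv0, enorm_zero]; exact zero_le
  have hlip : LipschitzWith _ ((innerSL ℝ v).comp B) := ((innerSL ℝ v).comp B).lipschitz
  have hint := (hx.lipschitzWith_comp hlip).integral_deriv_eq_sub
  have hval : ((innerSL ℝ v).comp B) (x b) - ((innerSL ℝ v).comp B) (x a) = ‖v‖ ^ 2 := by
    rw [← map_sub, ContinuousLinearMap.comp_apply, innerSL_apply_apply, ← hv,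
      real_inner_self_eq_norm_sq]
  rw [hval, intervalIntegral.integral_of_le hab] at hint
  have h1 : ‖v‖ₑ * ‖v‖ₑ ≤ ‖v‖ₑ * ∫⁻ t in Set.Ioc a b, ‖B (deriv x t)‖ₑ := by
    calc ‖v‖ₑ * ‖v‖ₑ = ‖‖v‖ ^ 2‖ₑ := by rw [enorm_pow, enorm_norm, sq]
      _ ≤ ∫⁻ t in Set.Ioc a b, ‖deriv (fun t => ((innerSL ℝ v).comp B) (x t)) t‖ₑ := by
          rw [← hint]; exact enorm_integral_le_lintegral_enorm _
      _ ≤ ∫⁻ t in Set.Ioc a b, ‖v‖ₑ * ‖B (deriv x t)‖ₑ := by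
          refine lintegral_mono_ae ((ae_restrict_iff' measurableSet_Ioc).2 ?_)
          filter_upwards [hd] with t ht htm
          have := (((innerSL ℝ v).comp B).hasFDerivAt.comp_hasDerivAt t (ht htm).hasDerivAt).deriv
          rw [Function.comp_def] at this
          rw [this, ContinuousLinearMap.comp_apply, innerSL_apply_apply]
          simp only [← ofReal_norm]
          rw [← ENNReal.ofReal_mul (norm_nonneg _)]
          exact ENNReal.ofReal_le_ofReal (norm_inner_le_norm _ _)
      _ = _ := lintegral_const_mul' _ _ enorm_ne_top
  exact (ENNReal.mul_le_mul_iff_right (by simpa using hv0) enorm_ne_top).1 h1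

namespace DelayLMI

variable {E : Type*} [NormedAddCommGroup E] [InnerProductSpace ℝ E]

/-- A solution of `ẋ(t) = A₀ x(t) + A₁ x(t - τ(t))`, `t > t₀`, that is continuous on the whole
line. -/
structure IsGlobalSolution (A₀ A₁ : E →L[ℝ] E) (τ : ℝ → ℝ) (t₀ : ℝ) (x : ℝ → E) : Prop where
  continuous : Continuous x
  absolutelyContinuous : ∀ t, t₀ ≤ t → AbsolutelyContinuousOnInterval x t₀ t
  ae_hasDerivAt : ∀ᵐ t : ℝ, t₀ < t → HasDerivAt x (A₀ (x t) + A₁ (x (t - τ t))) t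

namespace IsGlobalSolution

variable {A₀ A₁ : E →L[ℝ] E} {τ : ℝ → ℝ} {t₀ : ℝ} {x : ℝ → E}

theorem enorm_map_sub_le (hx : IsGlobalSolution A₀ A₁ τ t₀ x) {a b : ℝ} (ha : t₀ ≤ a) (hab : a ≤ b)
    (B : E →L[ℝ] E) : ‖B (x b - x a)‖ₑ ≤ ∫⁻ t in Set.Ioc a b, ‖B (deriv x t)‖ₑ := by
  refine AbsolutelyContinuousOnInterval.enorm_map_sub_le hab
    ((hx.absolutelyContinuous b (ha.trans hab)).mono ?_) ?_ B
  · rw [Set.uIcc_of_le hab, Set.uIcc_of_le (ha.trans hab)]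
    exact Set.Icc_subset_Icc_left ha
  · filter_upwards [hx.ae_hasDerivAt] with t ht htm
    exact (ht (ha.trans_lt htm.1)).differentiableAt

theorem norm_sub_le (hx : IsGlobalSolution A₀ A₁ τ t₀ x) {a b : ℝ} (ha : t₀ ≤ a) (hab : a ≤ b)
    {ψ : ℝ → ℝ} (hψ : IntegrableOn ψ (Set.Ioc a b))
    (hle : ∀ᵐ t, t ∈ Set.Ioc a b → ‖deriv x t‖ ≤ ψ t) :
    ‖x b - x a‖ ≤ ∫ t in Set.Ioc a b, ψ t := by
  have h := hx.enorm_map_sub_le ha hab (ContinuousLinearMap.id ℝ E)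
  simp only [ContinuousLinearMap.coe_id', id_eq] at h
  have hle' := (ae_restrict_iff' measurableSet_Ioc).2 hle
  have h0 : 0 ≤ᵐ[volume.restrict (Set.Ioc a b)] ψ := by
    filter_upwards [hle'] with t ht using (norm_nonneg _).trans ht
  have h2 : ∫⁻ t in Set.Ioc a b, ‖deriv x t‖ₑ ≤ ENNReal.ofReal (∫ t in Set.Ioc a b, ψ t) := by
    rw [ofReal_integral_eq_lintegral_ofReal hψ h0]
    refine lintegral_mono_ae ?_
    filter_upwards [hle'] with t ht
    rw [← ofReal_norm]
    exact ENNReal.ofReal_le_ofReal ht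
  have h3 := h.trans h2
  rw [← ofReal_norm] at h3
  exact (ENNReal.ofReal_le_ofReal_iff (integral_nonneg_of_ae h0)).1 h3

theorem ae_norm_deriv_le (hx : IsGlobalSolution A₀ A₁ τ t₀ x) :
    ∀ᵐ t, t₀ < t → ‖deriv x t‖ ≤ ‖A₀‖ * ‖x t‖ + ‖A₁‖ * ‖x (t - τ t)‖ := by
  filter_upwards [hx.ae_hasDerivAt] with t ht h
  rw [(ht h).deriv]
  exact (norm_add_le _ _).trans (add_le_add (A₀.le_opNorm _) (A₁.le_opNorm _))

/-- A priori bound of Gronwall type. -/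
theorem norm_le_exp (hx : IsGlobalSolution A₀ A₁ τ t₀ x) {r D : ℝ} (hr : 0 ≤ r)
    (hτ : ∀ t, t₀ ≤ t → 0 ≤ τ t ∧ τ t ≤ r) (hD : ∀ s ∈ Set.Icc (t₀ - r) t₀, ‖x s‖ ≤ D)
    {t : ℝ} (ht : t₀ ≤ t) :
    ‖x t‖ ≤ 2 * D * Real.exp ((2 * (‖A₀‖ + ‖A₁‖) + 1) * (t - t₀)) := by
  set K := ‖A₀‖ + ‖A₁‖ with hK
  have hK0 : 0 ≤ K := by positivity
  -- The weight `exp(-l(t - t₀))` has rate `l > 2K`, so that `K/l ≤ 1/2`. The maximum `M` of the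
  -- weighted norm then obeys `M ≤ D + M/2`.
  set l := 2 * K + 1 with hl
  have hl0 : 0 < l := by positivity
  have hD0 : 0 ≤ D := (norm_nonneg _).trans (hD t₀ ⟨by linarith, le_rfl⟩)
  have hcont : Continuous fun s => Real.exp (-(l * (s - t₀))) * ‖x s‖ := by
    have := hx.continuous; fun_prop
  obtain ⟨s₀, ⟨hs1, hs2⟩, hmax⟩ := (isCompact_Icc (a := t₀) (b := t)).exists_isMaxOn
    ⟨t₀, le_rfl, ht⟩ hcont.continuousOn
  set M := Real.exp (-(l * (s₀ - t₀))) * ‖x s₀‖ with hM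
  have hbd : ∀ s ∈ Set.Icc t₀ t, ‖x s‖ ≤ M * Real.exp (l * (s - t₀)) := by
    intro s hs
    have h1 : Real.exp (-(l * (s - t₀))) * ‖x s‖ ≤ M := hmax hs
    calc ‖x s‖ = (Real.exp (-(l * (s - t₀))) * ‖x s‖) * Real.exp (l * (s - t₀)) := by
          rw [mul_right_comm, ← Real.exp_add]; simp
      _ ≤ _ := by gcongr
  suffices hMD : M ≤ 2 * D by
    refine (hbd t ⟨ht, le_rfl⟩).trans ?_
    gcongr
  -- Assuming `M > 2D` also yields `D ≤ M`, so delayed arguments falling into the initial interval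
  -- obey the same exponential bound.
  by_contra hcon
  push Not at hcon
  have hMD : D ≤ M := by linarith
  have hM0 : 0 ≤ M := hD0.trans hMD
  have hde : ∀ᵐ σ, σ ∈ Set.Ioc t₀ s₀ → ‖deriv x σ‖ ≤ K * M * Real.exp (l * (σ - t₀)) := by
    filter_upwards [hx.ae_norm_deriv_le] with σ hσ hσm
    refine (hσ hσm.1).trans ?_
    have hτσ := hτ σ hσm.1.le
    have h1 := hbd σ ⟨hσm.1.le, hσm.2.trans hs2⟩
    have h2 : ‖x (σ - τ σ)‖ ≤ M * Real.exp (l * (σ - t₀)) := by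
      rcases le_total t₀ (σ - τ σ) with h | h
      · refine (hbd _ ⟨h, by linarith [hσm.2]⟩).trans ?_
        gcongr
        linarith
      · refine (hD _ ⟨by linarith [hσm.1], h⟩).trans (hMD.trans ?_)
        refine le_mul_of_one_le_right hM0 (Real.one_le_exp ?_)
        exact mul_nonneg hl0.le (by linarith [hσm.1])
    calc _ ≤ ‖A₀‖ * (M * Real.exp (l * (σ - t₀))) + ‖A₁‖ * (M * Real.exp (l * (σ - t₀))) := by gcongr
      _ = _ := by rw [hK]; ring
  have hψc : Continuous fun σ => K * M * Real.exp (l * (σ - t₀)) := by fun_prop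
  have h1 := hx.norm_sub_le le_rfl hs1
    (hψc.integrableOn_Icc.mono_set Set.Ioc_subset_Icc_self) hde
  have hder : ∀ σ ∈ Set.uIcc t₀ s₀, HasDerivAt (fun σ => K * M / l * Real.exp (l * (σ - t₀)))
      (K * M * Real.exp (l * (σ - t₀))) σ := by
    intro σ _
    have := ((((hasDerivAt_id σ).sub_const t₀).const_mul l).exp).const_mul (K * M / l)
    refine this.congr_deriv ?_
    simp only [id]
    field_simp
  rw [← intervalIntegral.integral_of_le hs1, intervalIntegral.integral_eq_sub_of_hasDerivAt hder
    (hψc.intervalIntegrable _ _)] at h1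
  simp only [sub_self, mul_zero, Real.exp_zero, mul_one] at h1
  have h2 : ‖x s₀‖ ≤ D + K * M / l * Real.exp (l * (s₀ - t₀)) := by
    have h3 := norm_le_norm_add_norm_sub' (x s₀) (x t₀)
    have h4 := hD t₀ ⟨by linarith, le_rfl⟩
    have h5 : 0 ≤ K * M / l := by positivity
    linarith
  have h3 : M ≤ D + K * M / l := by
    have hE : Real.exp (-(l * (s₀ - t₀))) ≤ 1 := by
      rw [Real.exp_le_one_iff]; nlinarith
    calc M ≤ Real.exp (-(l * (s₀ - t₀))) * (D + K * M / l * Real.exp (l * (s₀ - t₀))) := by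
          rw [hM]; gcongr
      _ = Real.exp (-(l * (s₀ - t₀))) * D + K * M / l := by
          rw [mul_add, mul_left_comm, ← Real.exp_add]; simp
      _ ≤ _ := by nlinarith
  have h4 : K * M / l ≤ M / 2 := by
    rw [div_le_iff₀ hl0, hl]; nlinarith
  linarith

end IsGlobalSolution
end DelayLMI

/-! ### The integrated Lyapunov–Krasovskii inequality. -/

theorem setIntegral_Ioc_split {f : ℝ → ℝ} {a b c : ℝ} (hab : a ≤ b) (hbc : b ≤ c)
    (hf : IntegrableOn f (Set.Ioc a c)) :
    ∫ t in Set.Ioc a c, f t = (∫ t in Set.Ioc a b, f t) + ∫ t in Set.Ioc b c, f t := by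
  rw [← Set.Ioc_union_Ioc_eq_Ioc hab hbc] at hf ⊢
  exact setIntegral_union (Set.Ioc_disjoint_Ioc_of_le le_rfl) measurableSet_Ioc
    hf.left_of_union hf.right_of_union

namespace DelayLMI

/-- `C` bounds the square of the norm, in `L²`, of the operator `w ↦ ∫ w` over the interval between
`t - τ(t)` and `t - h`. -/
def DelayBound (τ : ℝ → ℝ) (h C : ℝ) : Prop :=
  ∀ w : ℝ → ℝ≥0∞, Measurable w →
    ∫⁻ t in Set.Ici 0, (∫⁻ s in Set.uIoc (t - τ t) (t - h), w s) ^ 2 ≤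
      ENNReal.ofReal C * ∫⁻ s, w s ^ 2

variable {E : Type*} [NormedAddCommGroup E] [InnerProductSpace ℝ E]

namespace IsGlobalSolution

variable {A₀ A₁ : E →L[ℝ] E} {τ : ℝ → ℝ} {t₀ : ℝ} {x : ℝ → E}

theorem enorm_map_sub_le_uIoc (hx : IsGlobalSolution A₀ A₁ τ t₀ x) {a b : ℝ} (ha : t₀ ≤ a)
    (hb : t₀ ≤ b) (B : E →L[ℝ] E) :
    ‖B (x b - x a)‖ₑ ≤ ∫⁻ t in Set.uIoc a b, ‖B (deriv x t)‖ₑ := by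
  rcases le_total a b with h | h
  · rw [Set.uIoc_of_le h]; exact hx.enorm_map_sub_le ha h B
  · rw [Set.uIoc_of_ge h, ← neg_sub, map_neg, enorm_neg]; exact hx.enorm_map_sub_le hb h B

/-- Local boundedness of the derivative. -/
theorem exists_norm_deriv_le (hx : IsGlobalSolution A₀ A₁ τ t₀ x) {r : ℝ}
    (hτ : ∀ t, t₀ ≤ t → 0 ≤ τ t ∧ τ t ≤ r) (T : ℝ) :
    ∃ C, 0 ≤ C ∧ (∀ t ∈ Set.Icc (t₀ - r) T, ‖x t‖ ≤ C) ∧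
      ∀ᵐ t, t ∈ Set.Ioc t₀ T → ‖deriv x t‖ ≤ C := by
  obtain ⟨C, hC⟩ := (isCompact_Icc (a := t₀ - r) (b := T)).exists_bound_of_continuousOn
    hx.continuous.continuousOn
  have hC' : ∀ t ∈ Set.Icc (t₀ - r) T, ‖x t‖ ≤ max C 0 := fun t ht => (hC t ht).trans (le_max_left _ _)
  set D := max C 0 with hD
  have hD0 : 0 ≤ D := le_max_right _ _
  refine ⟨D + (‖A₀‖ + ‖A₁‖) * D, by positivity, fun t ht => (hC' t ht).trans ?_, ?_⟩
  · have : 0 ≤ (‖A₀‖ + ‖A₁‖) * D := by positivity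
    linarith
  filter_upwards [hx.ae_norm_deriv_le] with t ht htm
  have h1 := hτ t htm.1.le
  have h2 := hC' t ⟨by linarith [htm.1], htm.2⟩
  have h3 := hC' (t - τ t) ⟨by linarith [htm.1], by linarith [htm.2]⟩
  calc _ ≤ ‖A₀‖ * ‖x t‖ + ‖A₁‖ * ‖x (t - τ t)‖ := ht htm.1
    _ ≤ ‖A₀‖ * D + ‖A₁‖ * D := by gcongr
    _ ≤ _ := by linarith

variable [MeasurableSpace E] [BorelSpace E]

/-- An operator bound for scalar functions passes to increments of the solution by applying it to `w
= ‖B ẋ‖` cut off outside `(c, T]`. All the intervals involved lie there, so the cut-off loses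
nothing. -/
theorem integral_normSq_map_sub_le [CompleteSpace E] (hx : IsGlobalSolution A₀ A₁ τ t₀ x)
    {α β : ℝ → ℝ} {t₁ T c C : ℝ} (B : E →L[ℝ] E) (hC : 0 ≤ C) (hc : t₀ ≤ c)
    (hα : ∀ t ∈ Set.Ioc t₁ T, c ≤ α t ∧ α t ≤ T) (hβ : ∀ t ∈ Set.Ioc t₁ T, c ≤ β t ∧ β t ≤ T)
    (hint : IntegrableOn (fun t => ‖B (x (β t) - x (α t))‖ ^ 2) (Set.Ioc t₁ T))
    (hint' : IntegrableOn (fun t => ‖B (deriv x t)‖ ^ 2) (Set.Ioc c T))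
    (hop : ∀ w : ℝ → ℝ≥0∞, Measurable w →
      ∫⁻ t in Set.Ioc t₁ T, (∫⁻ s in Set.uIoc (α t) (β t), w s) ^ 2 ≤
        ENNReal.ofReal C * ∫⁻ s, w s ^ 2) :
    ∫ t in Set.Ioc t₁ T, ‖B (x (β t) - x (α t))‖ ^ 2 ≤
      C * ∫ t in Set.Ioc c T, ‖B (deriv x t)‖ ^ 2 := by
  have hsq : ∀ v : E, ENNReal.ofReal (‖v‖ ^ 2) = ‖v‖ₑ ^ 2 := fun v => by
    rw [ENNReal.ofReal_pow (norm_nonneg _), ofReal_norm]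
  have hBm : Measurable fun t => ‖B (deriv x t)‖ₑ :=
    (B.measurable.comp (measurable_deriv x)).enorm
  have hI0 : 0 ≤ ∫ t in Set.Ioc c T, ‖B (deriv x t)‖ ^ 2 := integral_nonneg fun t => by positivity
  rw [← ENNReal.ofReal_le_ofReal_iff (mul_nonneg hC hI0),
    ofReal_integral_eq_lintegral_ofReal hint (Eventually.of_forall fun t => by positivity),
    ENNReal.ofReal_mul hC,
    ofReal_integral_eq_lintegral_ofReal hint' (Eventually.of_forall fun t => by positivity)]
  simp only [hsq]
  set w : ℝ → ℝ≥0∞ := (Set.Ioc c T).indicator fun t => ‖B (deriv x t)‖ₑ with hw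
  calc _ ≤ ∫⁻ t in Set.Ioc t₁ T, (∫⁻ s in Set.uIoc (α t) (β t), w s) ^ 2 := by
        refine setLIntegral_mono' measurableSet_Ioc fun t ht => ?_
        gcongr
        refine (hx.enorm_map_sub_le_uIoc (hc.trans (hα t ht).1) (hc.trans (hβ t ht).1) B).trans ?_
        refine setLIntegral_mono' measurableSet_uIoc fun s hs => ?_
        rw [hw, Set.indicator_of_mem]
        rw [Set.mem_uIoc] at hs
        have h1 := hα t ht
        have h2 := hβ t ht
        rcases hs with hs | hs <;> constructor <;> linarith [hs.1, hs.2]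
    _ ≤ ENNReal.ofReal C * ∫⁻ s, w s ^ 2 := hop w (hBm.indicator measurableSet_Ioc)
    _ = _ := by
        congr 1
        rw [← lintegral_indicator measurableSet_Ioc]
        refine lintegral_congr fun s => ?_
        by_cases h : s ∈ Set.Ioc c T <;> simp [hw, h]

/-- The integrated Lyapunov-Krasovskii inequality along a solution. -/
theorem energy_le [CompleteSpace E] [SecondCountableTopology E] (hx : IsGlobalSolution A₀ A₁ τ t₀ x)
    {V S R Rₐ : E →L[ℝ] E} {h μ F ε t₁ T : ℝ} (hh : 0 < h) (hμ : 0 < μ) (hF : 0 ≤ F)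
    (ht₀ : 0 ≤ t₀) (ht₁ : t₀ + (h + μ) ≤ t₁) (hT : t₁ ≤ T) (hμh : μ ≤ h)
    (hτm : AEMeasurable τ (volume.restrict (Set.Ici 0)))
    (hτ : ∀ t, 0 ≤ t → h - μ ≤ τ t ∧ τ t ≤ h + μ)
    (hdiss : ∀ x y ζ u : E, y = A₀ x + A₁ (ζ - u) →
      2 * inner ℝ (V x) (V y) + ‖S x‖ ^ 2 - ‖S ζ‖ ^ 2 + h * ‖R y‖ ^ 2 - h⁻¹ * ‖R (x - ζ)‖ ^ 2
        - μ⁻¹ * ‖Rₐ u‖ ^ 2 + μ * F * ‖Rₐ y‖ ^ 2 + ε * (‖x‖ ^ 2 + ‖y‖ ^ 2) ≤ 0)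
    (hop : DelayBound τ h (F * μ ^ 2)) :
    ‖V (x T)‖ ^ 2 + ε * ∫ t in Set.Ioc t₁ T, (‖x t‖ ^ 2 + ‖deriv x t‖ ^ 2) ≤
      ‖V (x t₁)‖ ^ 2 + (∫ t in Set.Ioc (t₁ - h) t₁, ‖S (x t)‖ ^ 2)
        + h * (∫ t in Set.Ioc (t₁ - h) t₁, ‖R (deriv x t)‖ ^ 2)
        + μ * F * ∫ t in Set.Ioc (t₁ - h - μ) t₁, ‖Rₐ (deriv x t)‖ ^ 2 := by
  have hxc := hx.continuous
  obtain ⟨C, hC0, hCx, hCy⟩ := hx.exists_norm_deriv_le (r := h + μ)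
    (fun t ht => ⟨by linarith [(hτ t (ht₀.trans ht)).1], (hτ t (ht₀.trans ht)).2⟩) T
  have hym : Measurable (deriv x) := measurable_deriv x
  have bdd : ∀ {a : ℝ} {f : ℝ → E} (B : E →L[ℝ] E),
      AEMeasurable f (volume.restrict (Set.Ioc a T)) →
      (∃ D, ∀ᵐ t, t ∈ Set.Ioc a T → ‖f t‖ ≤ D) →
      IntegrableOn (fun t => ‖B (f t)‖ ^ 2) (Set.Ioc a T) := by
    rintro a f B hf ⟨D, hD⟩
    refine Integrable.of_bound (C := (‖B‖ * D) ^ 2) ?_ ?_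
    · exact ((B.measurable.comp_aemeasurable hf).norm.pow_const 2).aestronglyMeasurable
    · refine (ae_restrict_iff' measurableSet_Ioc).2 ?_
      filter_upwards [hD] with t ht htm
      rw [norm_pow, norm_norm]
      gcongr
      exact (B.le_opNorm _).trans (by gcongr; exact ht htm)
  have hy : ∀ {a : ℝ} (B : E →L[ℝ] E), t₀ ≤ a →
      IntegrableOn (fun t => ‖B (deriv x t)‖ ^ 2) (Set.Ioc a T) := fun {a} B ha =>
    bdd B hym.aemeasurable ⟨C, by
      filter_upwards [hCy] with t ht htm using ht ⟨ha.trans_lt htm.1, htm.2⟩⟩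
  have hcontI : ∀ {a b : ℝ} {f : ℝ → ℝ}, Continuous f → IntegrableOn f (Set.Ioc a b) :=
    fun hf => hf.integrableOn_Icc.mono_set Set.Ioc_subset_Icc_self
  -- the individual terms
  set s : ℝ → ℝ := fun t => ‖S (x t)‖ ^ 2 with hs
  have hsc : Continuous s := by fun_prop
  have i2 : IntegrableOn s (Set.Ioc t₁ T) := hcontI hsc
  have i3 : IntegrableOn (fun t => s (t - h)) (Set.Ioc t₁ T) := hcontI (by fun_prop)
  have i4 := hy (a := t₁) R (by linarith)
  have i5 : IntegrableOn (fun t => ‖R (x t - x (t - h))‖ ^ 2) (Set.Ioc t₁ T) :=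
    hcontI (by fun_prop)
  have hτm' : AEMeasurable τ (volume.restrict (Set.Ioc t₁ T)) :=
    hτm.mono_measure (Measure.restrict_mono (fun t ht => by
      show 0 ≤ t
      linarith [ht.1]) le_rfl)
  have i6 : IntegrableOn (fun t => ‖Rₐ (x (t - h) - x (t - τ t))‖ ^ 2) (Set.Ioc t₁ T) := by
    refine bdd Rₐ (AEMeasurable.sub (by fun_prop)
      (hxc.measurable.comp_aemeasurable (aemeasurable_id.sub hτm'))) ⟨C + C, ?_⟩
    refine Eventually.of_forall fun t ht => ?_
    have h1 := hτ t (by linarith [ht.1])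
    refine (_root_.norm_sub_le _ _).trans (add_le_add (hCx _ ⟨?_, ?_⟩) (hCx _ ⟨?_, ?_⟩)) <;>
      linarith [ht.1, ht.2]
  have i7 := hy (a := t₁) Rₐ (by linarith)
  have i8 : IntegrableOn (fun t => ‖x t‖ ^ 2 + ‖deriv x t‖ ^ 2) (Set.Ioc t₁ T) :=
    (hcontI (by fun_prop)).add (by simpa using hy (a := t₁) (ContinuousLinearMap.id ℝ E) (by linarith))
  -- The square is written as a product because absolute continuity passes to products.
  set v : ℝ → ℝ := fun t => ‖V (x t)‖ * ‖V (x t)‖ with hv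
  have hvac : AbsolutelyContinuousOnInterval v t₁ T := by
    have h1 : AbsolutelyContinuousOnInterval x t₁ T :=
      (hx.absolutelyContinuous T (by linarith)).mono (by
        rw [Set.uIcc_of_le hT, Set.uIcc_of_le (by linarith)]
        exact Set.Icc_subset_Icc_left (by linarith))
    have h2 := h1.lipschitzWith_comp (lipschitzWith_one_norm.comp V.lipschitz)
    exact h2.mul h2
  have i1 : IntegrableOn (deriv v) (Set.Ioc t₁ T) :=
    (intervalIntegrable_iff_integrableOn_Ioc_of_le hT).1 hvac.intervalIntegrable_deriv
  have e1 : ∫ t in Set.Ioc t₁ T, deriv v t = ‖V (x T)‖ ^ 2 - ‖V (x t₁)‖ ^ 2 := by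
    rw [← intervalIntegral.integral_of_le hT, hvac.integral_deriv_eq_sub, hv, sq, sq]
  have key : ∀ᵐ t ∂(volume.restrict (Set.Ioc t₁ T)),
      deriv v t + s t - s (t - h) + h * ‖R (deriv x t)‖ ^ 2 - h⁻¹ * ‖R (x t - x (t - h))‖ ^ 2
        - μ⁻¹ * ‖Rₐ (x (t - h) - x (t - τ t))‖ ^ 2 + μ * F * ‖Rₐ (deriv x t)‖ ^ 2
        + ε * (‖x t‖ ^ 2 + ‖deriv x t‖ ^ 2) ≤ 0 := by
    refine (ae_restrict_iff' measurableSet_Ioc).2 ?_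
    filter_upwards [hx.ae_hasDerivAt] with t ht htm
    have hd := ht (by linarith [htm.1])
    have hdv : deriv v t = 2 * inner ℝ (V (x t)) (V (deriv x t)) := by
      have h1 := (V.hasFDerivAt.comp_hasDerivAt t hd).norm_sq
      have h2 : v = fun t => ‖(V ∘ x) t‖ ^ 2 := by
        ext t; simp only [hv, Function.comp, sq]
      rw [h2, hd.deriv]
      exact h1.deriv
    rw [hdv]
    -- Here `ζ = x(t - h)` and `u = x(t - h) - x(t - τ t)`, hence `ζ - u` is the delayed state.
    refine hdiss _ _ _ _ ?_
    rw [hd.deriv, sub_sub_cancel]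
  have hsum := integral_nonpos_of_ae key
  have j2 := i1.add i2
  have j3 := j2.sub i3
  have j4 := j3.add (i4.const_mul h)
  have j5 := j4.sub (i5.const_mul h⁻¹)
  have j6 := j5.sub (i6.const_mul μ⁻¹)
  have j7 := j6.add (i7.const_mul (μ * F))
  rw [integral_add (by exact j7) (by exact i8.const_mul _),
    integral_add (by exact j6) (by exact i7.const_mul _),
    integral_sub (by exact j5) (by exact i6.const_mul _),
    integral_sub (by exact j4) (by exact i5.const_mul _),
    integral_add (by exact j3) (by exact i4.const_mul h),
    integral_sub (by exact j2) (by exact i3),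
    integral_add (by exact i1) (by exact i2), e1] at hsum
  simp only [integral_const_mul] at hsum
  -- telescoping of the term with `S`
  have e3 : ∫ t in Set.Ioc t₁ T, s (t - h) = ∫ t in Set.Ioc (t₁ - h) (T - h), s t := by
    rw [← intervalIntegral.integral_of_le hT, intervalIntegral.integral_comp_sub_right,
      intervalIntegral.integral_of_le (by linarith)]
  have e23 : (∫ t in Set.Ioc (t₁ - h) (T - h), s t) ≤
      (∫ t in Set.Ioc (t₁ - h) t₁, s t) + ∫ t in Set.Ioc t₁ T, s t := by
    rw [← setIntegral_Ioc_split (by linarith) hT (hcontI hsc),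
      setIntegral_Ioc_split (a := t₁ - h) (b := T - h) (c := T) (by linarith) (by linarith)
        (hcontI hsc)]
    have : 0 ≤ ∫ t in Set.Ioc (T - h) T, s t := integral_nonneg fun t => by positivity
    linarith
  -- the term with `R`
  have e5 : ∫ t in Set.Ioc t₁ T, ‖R (x t - x (t - h))‖ ^ 2 ≤
      h ^ 2 * ∫ t in Set.Ioc (t₁ - h) T, ‖R (deriv x t)‖ ^ 2 := by
    refine hx.integral_normSq_map_sub_le (α := fun t => t - h) (β := fun t => t) R (by positivity)
      (by linarith) (fun t ht => ⟨?_, ?_⟩) (fun t ht => ⟨?_, ht.2⟩) i5 (hy R (by linarith))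
      (fun w hw => ?_)
    · linarith [ht.1]
    · linarith [ht.2]
    · linarith [ht.1]
    · refine (setLIntegral_le_lintegral _ _).trans ?_
      -- A constant delay of length `h` is the case `p = 0`, where the factor is `1`.
      have := lintegral_sq_delay_le_of_nonneg (g := fun t => t - h) (by fun_prop) (μ := h) (p := 0)
        (fun t => by rw [sub_sub_cancel, abs_of_pos hh]) le_rfl (fun a b hab => by
          linarith) hw
      simpa using this
  rw [setIntegral_Ioc_split (b := t₁) (by linarith) hT (hy R (by linarith))] at e5
  -- the term with `Rₐ`
  have e6 : ∫ t in Set.Ioc t₁ T, ‖Rₐ (x (t - h) - x (t - τ t))‖ ^ 2 ≤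
      F * μ ^ 2 * ∫ t in Set.Ioc (t₁ - h - μ) T, ‖Rₐ (deriv x t)‖ ^ 2 := by
    refine hx.integral_normSq_map_sub_le (α := fun t => t - τ t) (β := fun t => t - h) Rₐ
      (by positivity) (by linarith) (fun t ht => ?_) (fun t ht => ⟨?_, ?_⟩) i6
      (hy Rₐ (by linarith)) (fun w hw => ?_)
    · have := hτ t (by linarith [ht.1])
      constructor <;> linarith [ht.1, ht.2]
    · linarith [ht.1]
    · linarith [ht.2]
    · refine (lintegral_mono_set fun t ht => ?_).trans (hop w hw)
      show 0 ≤ t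
      linarith [ht.1]
  rw [setIntegral_Ioc_split (b := t₁) (by linarith) hT (hy Rₐ (by linarith))] at e6
  -- After this scaling the integrals over `(t₁, T]` cancel against the positive terms of `hsum`;
  -- only those over the window before `t₁` survive.
  have e5' := mul_le_mul_of_nonneg_left e5 (inv_nonneg.2 hh.le)
  have e6' := mul_le_mul_of_nonneg_left e6 (inv_nonneg.2 hμ.le)
  rw [← mul_assoc, show h⁻¹ * h ^ 2 = h by field_simp] at e5'
  rw [← mul_assoc, show μ⁻¹ * (F * μ ^ 2) = μ * F by field_simp] at e6'
  rw [e3] at hsum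
  linarith

end IsGlobalSolution
end DelayLMI

/-! ### Boundedness and convergence of solutions. -/

namespace DelayLMI

theorem setIntegral_Ioc_le_of_norm_le {f : ℝ → ℝ} {a b C : ℝ} (hab : a ≤ b)
    (hf : ∀ᵐ t, t ∈ Set.Ioc a b → ‖f t‖ ≤ C) : ∫ t in Set.Ioc a b, f t ≤ C * (b - a) := by
  refine (Real.le_norm_self _).trans
    ((norm_setIntegral_le_of_norm_le_const_ae (by simp)
      ((ae_restrict_iff' measurableSet_Ioc).2 hf)).trans ?_)
  rw [Real.volume_real_Ioc_of_le hab]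

variable {E : Type*} [NormedAddCommGroup E] [InnerProductSpace ℝ E] [MeasurableSpace E]
  [BorelSpace E] [CompleteSpace E]

namespace IsGlobalSolution

variable {A₀ A₁ : E →L[ℝ] E} {τ : ℝ → ℝ} {t₀ : ℝ} {x : ℝ → E}

theorem integrableOn_energy (hx : IsGlobalSolution A₀ A₁ τ t₀ x) {r : ℝ}
    (hτ : ∀ t, t₀ ≤ t → 0 ≤ τ t ∧ τ t ≤ r) {a T : ℝ} (ha : t₀ ≤ a) :
    IntegrableOn (fun t => ‖x t‖ ^ 2 + ‖deriv x t‖ ^ 2) (Set.Ioc a T) := by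
  have hxc := hx.continuous
  obtain ⟨C, -, -, hC⟩ := hx.exists_norm_deriv_le hτ T
  refine Integrable.add ?_ (Integrable.of_bound (C := C ^ 2) ?_ ?_)
  · have : Continuous fun t => ‖x t‖ ^ 2 := by fun_prop
    exact this.integrableOn_Icc.mono_set Set.Ioc_subset_Icc_self
  · exact ((measurable_deriv x).norm.pow_const 2).aestronglyMeasurable
  · refine (ae_restrict_iff' measurableSet_Ioc).2 ?_
    filter_upwards [hC] with t ht htm
    rw [norm_pow, norm_norm]
    gcongr
    exact ht ⟨ha.trans_lt htm.1, htm.2⟩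

/-- The function `(s - (T-1))|x(s)|²` vanishes at `T - 1` and equals `|x(T)|²` at `T`. Its
derivative is at most `2|x|² + |ẋ|²` on the unit interval. -/
theorem norm_sq_le_integral (hx : IsGlobalSolution A₀ A₁ τ t₀ x) {r : ℝ}
    (hτ : ∀ t, t₀ ≤ t → 0 ≤ τ t ∧ τ t ≤ r) {T : ℝ} (hT : t₀ ≤ T - 1) :
    ‖x T‖ ^ 2 ≤ 2 * ∫ t in Set.Ioc (T - 1) T, (‖x t‖ ^ 2 + ‖deriv x t‖ ^ 2) := by
  set q : ℝ → ℝ := fun s => (s - (T - 1)) * (‖x s‖ * ‖x s‖) with hq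
  have hT1 : T - 1 ≤ T := by linarith
  have hac : AbsolutelyContinuousOnInterval x (T - 1) T :=
    (hx.absolutelyContinuous T (by linarith)).mono (by
      rw [Set.uIcc_of_le hT1, Set.uIcc_of_le (by linarith)]
      exact Set.Icc_subset_Icc_left hT)
  have hn := hac.lipschitzWith_comp lipschitzWith_one_norm
  have hid : AbsolutelyContinuousOnInterval (fun s : ℝ => s - (T - 1)) (T - 1) T :=
    LipschitzOnWith.absolutelyContinuousOnInterval (K := 1)
      (LipschitzWith.lipschitzOnWith (LipschitzWith.of_dist_le_mul fun a b => by
        simp [Real.dist_eq]))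
  have hqac : AbsolutelyContinuousOnInterval q (T - 1) T := hid.mul (hn.mul hn)
  have hint := hqac.integral_deriv_eq_sub
  have hqT : q T - q (T - 1) = ‖x T‖ ^ 2 := by simp only [hq]; ring
  rw [hqT, intervalIntegral.integral_of_le hT1] at hint
  rw [← hint, ← integral_const_mul]
  refine integral_mono_ae ((intervalIntegrable_iff_integrableOn_Ioc_of_le hT1).1
    hqac.intervalIntegrable_deriv) ((hx.integrableOn_energy hτ hT).const_mul 2) ?_
  refine (ae_restrict_iff' measurableSet_Ioc).2 ?_
  filter_upwards [hx.ae_hasDerivAt] with t ht htm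
  have hd := (ht (hT.trans_lt htm.1)).differentiableAt.hasDerivAt
  have h1 := ((hasDerivAt_id t).sub_const (T - 1)).mul hd.norm_sq
  have h2 : q = (fun s => id s - (T - 1)) * fun s => ‖x s‖ ^ 2 := by
    ext s; simp [hq, sq]
  rw [h2, h1.deriv]
  have h3 : inner ℝ (x t) (deriv x t) ≤ ‖x t‖ * ‖deriv x t‖ := real_inner_le_norm _ _
  have h4 : 0 ≤ t - (T - 1) := by linarith [htm.1]
  have h5 : t - (T - 1) ≤ 1 := by linarith [htm.2]
  simp only [id, one_mul]
  have h6 : (t - (T - 1)) * (2 * inner ℝ (x t) (deriv x t)) ≤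
      (t - (T - 1)) * (‖x t‖ ^ 2 + ‖deriv x t‖ ^ 2) := by
    refine mul_le_mul_of_nonneg_left ?_ h4
    nlinarith [sq_nonneg (‖x t‖ - ‖deriv x t‖)]
  have h7 : (t - (T - 1)) * (‖x t‖ ^ 2 + ‖deriv x t‖ ^ 2) ≤ ‖x t‖ ^ 2 + ‖deriv x t‖ ^ 2 :=
    mul_le_of_le_one_left (by positivity) h5
  have h8 := sq_nonneg ‖deriv x t‖
  linarith

/-- Square integrability of the solution and its derivative implies convergence to zero. -/
theorem tendsto_zero (hx : IsGlobalSolution A₀ A₁ τ t₀ x) {r : ℝ}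
    (hτ : ∀ t, t₀ ≤ t → 0 ≤ τ t ∧ τ t ≤ r) {t₁ C : ℝ} (ht₁ : t₀ ≤ t₁)
    (hC : ∀ T, t₁ ≤ T → ∫ t in Set.Ioc t₁ T, (‖x t‖ ^ 2 + ‖deriv x t‖ ^ 2) ≤ C) :
    Tendsto x atTop (𝓝 0) := by
  set Φ : ℝ → ℝ := fun T => ∫ t in Set.Ioc t₁ T, (‖x t‖ ^ 2 + ‖deriv x t‖ ^ 2) with hΦ
  have hmono : Monotone Φ := by
    intro a b hab
    exact setIntegral_mono_set (hx.integrableOn_energy hτ ht₁)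
      (Eventually.of_forall fun t => by simp only [Pi.zero_apply]; positivity)
      (Set.Ioc_subset_Ioc_right hab).eventuallyLE
  have hbdd : BddAbove (Set.range Φ) := by
    refine ⟨C, ?_⟩
    rintro _ ⟨T, rfl⟩
    exact (hmono (le_max_left T t₁)).trans (hC _ (le_max_right _ _))
  have hlim := tendsto_atTop_ciSup hmono hbdd
  -- The energy is monotone and bounded, so its share on unit windows tends to zero; that share
  -- controls `|x(T)|²`.
  have hlim' : Tendsto (fun T => Φ T - Φ (T - 1)) atTop (𝓝 0) := by
    have h1 : Tendsto (fun T : ℝ => T - 1) atTop atTop := tendsto_atTop_add_const_right _ _ tendsto_id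
    simpa using hlim.sub (hlim.comp h1)
  have hsq : Tendsto (fun T => ‖x T‖ ^ 2) atTop (𝓝 0) := by
    refine squeeze_zero' (Eventually.of_forall fun T => by positivity) ?_
      (by simpa using hlim'.const_mul 2)
    filter_upwards [eventually_ge_atTop (t₁ + 1)] with T hT
    have h1 := hx.norm_sq_le_integral hτ (T := T) (by linarith)
    have h2 : Φ T = Φ (T - 1) + _ := setIntegral_Ioc_split (b := T - 1) (by linarith) (by linarith)
      (hx.integrableOn_energy hτ ht₁)
    rw [h2, add_sub_cancel_left]
    exact h1
  rw [tendsto_zero_iff_norm_tendsto_zero]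
  have := hsq.sqrt
  simpa [Real.sqrt_sq] using this

end IsGlobalSolution

/-- Uniform boundedness and convergence of solutions under the dissipation inequality. -/
theorem exists_bound_of_dissipation [SecondCountableTopology E] (A₀ A₁ : E →L[ℝ] E) {τ : ℝ → ℝ}
    {V S R Rₐ : E →L[ℝ] E} {h μ F ε c t₀ : ℝ} (hμ : 0 < μ) (hμh : μ ≤ h) (hF : 0 ≤ F)
    (hε : 0 < ε) (hc : 0 < c) (ht₀ : 0 ≤ t₀)
    (hτm : AEMeasurable τ (volume.restrict (Set.Ici 0)))
    (hτ : ∀ t, 0 ≤ t → h - μ ≤ τ t ∧ τ t ≤ h + μ)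
    (hV : ∀ x : E, c * ‖x‖ ^ 2 ≤ ‖V x‖ ^ 2)
    (hdiss : ∀ x y ζ u : E, y = A₀ x + A₁ (ζ - u) →
      2 * inner ℝ (V x) (V y) + ‖S x‖ ^ 2 - ‖S ζ‖ ^ 2 + h * ‖R y‖ ^ 2 - h⁻¹ * ‖R (x - ζ)‖ ^ 2
        - μ⁻¹ * ‖Rₐ u‖ ^ 2 + μ * F * ‖Rₐ y‖ ^ 2 + ε * (‖x‖ ^ 2 + ‖y‖ ^ 2) ≤ 0)
    (hop : DelayBound τ h (F * μ ^ 2)) :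
    ∃ K, 0 ≤ K ∧ ∀ (x : ℝ → E) (D : ℝ), IsGlobalSolution A₀ A₁ τ t₀ x →
      (∀ s ∈ Set.Icc (t₀ - (h + μ)) t₀, ‖x s‖ ≤ D) →
        (∀ t, t₀ ≤ t → ‖x t‖ ≤ K * D) ∧ Tendsto x atTop (𝓝 0) := by
  have hh : 0 < h := hμ.trans_le hμh
  set r := h + μ with hr
  have hτ' : ∀ t, t₀ ≤ t → 0 ≤ τ t ∧ τ t ≤ r := fun t ht =>
    ⟨by linarith [(hτ t (ht₀.trans ht)).1], (hτ t (ht₀.trans ht)).2⟩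
  set M := 2 * Real.exp ((2 * (‖A₀‖ + ‖A₁‖) + 1) * r) with hM
  have hM1 : 1 ≤ M := by
    have : 1 ≤ Real.exp ((2 * (‖A₀‖ + ‖A₁‖) + 1) * r) := Real.one_le_exp (by positivity)
    linarith
  set N := (‖A₀‖ + ‖A₁‖) * M with hN
  have hN0 : 0 ≤ N := by positivity
  -- `Q D²` bounds the right side of `energy_le` at `t₁ = t₀ + h + μ`. `M` bounds the solution up to
  -- `t₁`, and `N` bounds its derivative on `(t₀, t₁]`, relative to `D`. Starting at `t₁` keeps
  -- every window inside `t ≥ t₀`, where the equation controls `ẋ`.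
  set Q := (‖V‖ * M) ^ 2 + (‖S‖ * M) ^ 2 * h + h * ((‖R‖ * N) ^ 2 * h)
    + μ * F * ((‖Rₐ‖ * N) ^ 2 * (h + μ)) with hQ
  have hQ0 : 0 ≤ Q := by positivity
  refine ⟨max M (Real.sqrt (Q / c)), le_max_of_le_right (Real.sqrt_nonneg _), ?_⟩
  intro x D hx hD
  have hD0 : 0 ≤ D := (norm_nonneg _).trans (hD t₀ ⟨by linarith, le_rfl⟩)
  set t₁ := t₀ + r with ht₁
  have hxM : ∀ t ∈ Set.Icc (t₀ - r) t₁, ‖x t‖ ≤ M * D := by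
    intro t ht
    rcases le_total t t₀ with h1 | h1
    · exact (hD t ⟨ht.1, h1⟩).trans (le_mul_of_one_le_left hD0 hM1)
    · refine (hx.norm_le_exp (by linarith) hτ' hD h1).trans ?_
      rw [hM, mul_right_comm]
      gcongr
      linarith [ht.2]
  have hyN : ∀ᵐ t, t ∈ Set.Ioc t₀ t₁ → ‖deriv x t‖ ≤ N * D := by
    filter_upwards [hx.ae_norm_deriv_le] with t ht htm
    have h1 := hτ' t htm.1.le
    have h2 := hxM t ⟨by linarith [htm.1], htm.2⟩
    have h3 := hxM (t - τ t) ⟨by linarith [htm.1], by linarith [htm.2]⟩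
    calc _ ≤ ‖A₀‖ * ‖x t‖ + ‖A₁‖ * ‖x (t - τ t)‖ := ht htm.1
      _ ≤ ‖A₀‖ * (M * D) + ‖A₁‖ * (M * D) := by gcongr
      _ = _ := by rw [hN]; ring
  have hB : ∀ (B : E →L[ℝ] E) {v : E} {k : ℝ}, ‖v‖ ≤ k * D → ‖B v‖ ^ 2 ≤ (‖B‖ * k) ^ 2 * D ^ 2 := by
    intro B v k hv
    rw [← mul_pow, mul_assoc]
    gcongr
    exact (B.le_opNorm v).trans (by gcongr)
  have henergy : ∀ T, t₁ ≤ T →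
      ‖V (x T)‖ ^ 2 + ε * ∫ t in Set.Ioc t₁ T, (‖x t‖ ^ 2 + ‖deriv x t‖ ^ 2) ≤ Q * D ^ 2 := by
    intro T hT
    refine (hx.energy_le hh hμ hF ht₀ le_rfl hT hμh hτm hτ hdiss hop).trans ?_
    have b1 := hB V (hxM t₁ ⟨by linarith, le_rfl⟩)
    have b2 : ∫ t in Set.Ioc (t₁ - h) t₁, ‖S (x t)‖ ^ 2 ≤ (‖S‖ * M) ^ 2 * D ^ 2 * (t₁ - (t₁ - h)) := by
      refine setIntegral_Ioc_le_of_norm_le (by linarith) (Eventually.of_forall fun t ht => ?_)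
      rw [norm_pow, norm_norm]
      exact hB S (hxM t ⟨by linarith [ht.1], ht.2⟩)
    have b3 : ∫ t in Set.Ioc (t₁ - h) t₁, ‖R (deriv x t)‖ ^ 2 ≤
        (‖R‖ * N) ^ 2 * D ^ 2 * (t₁ - (t₁ - h)) := by
      refine setIntegral_Ioc_le_of_norm_le (by linarith) ?_
      filter_upwards [hyN] with t ht htm
      rw [norm_pow, norm_norm]
      exact hB R (ht ⟨by linarith [htm.1], htm.2⟩)
    have b4 : ∫ t in Set.Ioc (t₁ - h - μ) t₁, ‖Rₐ (deriv x t)‖ ^ 2 ≤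
        (‖Rₐ‖ * N) ^ 2 * D ^ 2 * (t₁ - (t₁ - h - μ)) := by
      refine setIntegral_Ioc_le_of_norm_le (by linarith) ?_
      filter_upwards [hyN] with t ht htm
      rw [norm_pow, norm_norm]
      exact hB Rₐ (ht ⟨by linarith [htm.1], htm.2⟩)
    have b3' := mul_le_mul_of_nonneg_left b3 hh.le
    have b4' := mul_le_mul_of_nonneg_left b4 (mul_nonneg hμ.le hF)
    calc _ ≤ (‖V‖ * M) ^ 2 * D ^ 2 + (‖S‖ * M) ^ 2 * D ^ 2 * (t₁ - (t₁ - h))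
          + h * ((‖R‖ * N) ^ 2 * D ^ 2 * (t₁ - (t₁ - h)))
          + μ * F * ((‖Rₐ‖ * N) ^ 2 * D ^ 2 * (t₁ - (t₁ - h - μ))) := by gcongr
      _ = _ := by rw [hQ]; ring
  have hI0 : ∀ T, 0 ≤ ∫ t in Set.Ioc t₁ T, (‖x t‖ ^ 2 + ‖deriv x t‖ ^ 2) :=
    fun T => integral_nonneg fun t => by positivity
  constructor
  · intro t ht
    rcases le_total t t₁ with h1 | h1
    · refine (hxM t ⟨by linarith, h1⟩).trans ?_
      gcongr
      exact le_max_left _ _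
    · have h2 : c * ‖x t‖ ^ 2 ≤ Q * D ^ 2 := by
        have := henergy t h1
        have := hV (x t)
        have := mul_nonneg hε.le (hI0 t)
        linarith
      have h3 : ‖x t‖ ≤ Real.sqrt (Q / c) * D := by
        refine abs_le_of_sq_le_sq' ?_ (by positivity) |>.2
        rw [mul_pow, Real.sq_sqrt (by positivity), div_mul_eq_mul_div, le_div_iff₀ hc]
        linarith
      refine h3.trans ?_
      gcongr
      exact le_max_right _ _
  · refine hx.tendsto_zero hτ' (t₁ := t₁) (C := Q * D ^ 2 / ε) (by linarith) fun T hT => ?_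
    rw [le_div_iff₀ hε]
    have := henergy T hT
    have := sq_nonneg ‖V (x T)‖
    linarith

end DelayLMI

/-! ### From matrices and delays to the abstract estimates. -/

section
open Matrix

theorem AbsolutelyContinuousOnInterval.congr {X : Type*} [PseudoMetricSpace X] {f g : ℝ → X}
    {a b : ℝ} (hf : AbsolutelyContinuousOnInterval f a b) (hfg : ∀ t ∈ Set.uIcc a b, f t = g t) :
    AbsolutelyContinuousOnInterval g a b := by
  rw [absolutelyContinuousOnInterval_iff] at hf ⊢
  intro ε hε
  obtain ⟨δ, hδ, H⟩ := hf ε hε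
  refine ⟨δ, hδ, fun I hI hs => ?_⟩
  have h := H I hI hs
  have e : ∑ i ∈ Finset.range I.1, dist (f (I.2 i).1) (f (I.2 i).2) =
      ∑ i ∈ Finset.range I.1, dist (g (I.2 i).1) (g (I.2 i).2) :=
    Finset.sum_congr rfl fun i hi => by
      rw [hfg _ (hI.1 i hi).1, hfg _ (hI.1 i hi).2]
  rwa [e] at h

namespace DelayLMI

/-- The shift `θ = t - h` centres the problem: the interval between `t - τ` and `t - h` becomes the
one between `g θ` and `θ`. Changing `τ` on a null set does not affect the outer integral. -/
theorem delayBound_of_ae_eq {τ τ' : ℝ → ℝ} {h C : ℝ} (hτ' : Measurable τ')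
    (hττ' : ∀ᵐ t ∂(volume.restrict (Set.Ici 0)), τ t = τ' t)
    (hb : ∀ g : ℝ → ℝ, Measurable g → (∀ θ, g θ = θ + h - τ' (θ + h)) →
      ∀ w : ℝ → ℝ≥0∞, Measurable w →
      ∫⁻ t, (∫⁻ s in Set.uIoc (g t) t, w s) ^ 2 ≤ ENNReal.ofReal C * ∫⁻ s, w s ^ 2) :
    DelayBound τ h C := by
  intro w hw
  set g : ℝ → ℝ := fun θ => θ + h - τ' (θ + h) with hg
  have h1 := hb g (by fun_prop) (fun _ => rfl) w hw
  calc _ = ∫⁻ t in Set.Ici 0, (∫⁻ s in Set.uIoc (g (t - h)) (t - h), w s) ^ 2 := by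
        refine lintegral_congr_ae ?_
        filter_upwards [hττ'] with t ht
        simp only [hg, sub_add_cancel, ht]
    _ ≤ ∫⁻ t, (∫⁻ s in Set.uIoc (g (t - h)) (t - h), w s) ^ 2 := setLIntegral_le_lintegral _ _
    _ = ∫⁻ t, (∫⁻ s in Set.uIoc (g t) t, w s) ^ 2 :=
        lintegral_sub_right_eq_self (fun t => (∫⁻ s in Set.uIoc (g t) t, w s) ^ 2) h
    _ ≤ _ := h1

theorem IsUncertainDelay.mem_Icc {h μ : ℝ} {τ : ℝ → ℝ} (hτ : IsUncertainDelay h μ τ) {t : ℝ}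
    (ht : 0 ≤ t) : h - μ ≤ τ t ∧ τ t ≤ h + μ := by
  obtain ⟨-, η, hη⟩ := hτ
  obtain ⟨h1, h2⟩ := hη t ht
  have := abs_le.1 h2
  constructor <;> linarith

theorem IsFastVarying.delayBound {h μ : ℝ} {τ : ℝ → ℝ} (hτ : IsFastVarying τ)
    (hu : IsUncertainDelay h μ τ) : DelayBound τ h (boundFactorTop * μ ^ 2) := by
  have hμ : 0 ≤ μ := by linarith [(hu.mem_Icc le_rfl).1, (hu.mem_Icc le_rfl).2]
  set τ₁ := AEMeasurable.mk τ hτ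
  have hm : Measurable τ₁ := hτ.measurable_mk
  -- Clamping the measurable representative to `[h - μ, h + μ]` makes `|θ - g θ| ≤ μ` hold
  -- everywhere, negative times included.
  refine delayBound_of_ae_eq (τ' := fun t => max (h - μ) (min (h + μ) (τ₁ t))) (by fun_prop) ?_ ?_
  · filter_upwards [hτ.ae_eq_mk, ae_restrict_mem measurableSet_Ici] with t ht htm
    have := hu.mem_Icc (t := t) htm
    have ht' : τ₁ t = τ t := ht.symm
    rw [ht', min_eq_right this.2, max_eq_right this.1]
  · intro g hg hg' w hw
    refine lintegral_sq_delay_le_top hg (fun t => ?_) hw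
    have h1 : h - μ ≤ max (h - μ) (min (h + μ) (τ₁ (t + h))) := le_max_left _ _
    have h2 : max (h - μ) (min (h + μ) (τ₁ (t + h))) ≤ h + μ :=
      max_le (by linarith) (min_le_left _ _)
    rw [hg', abs_le]
    constructor <;> linarith

/-- Extending `τ` by its value at `0` to negative times preserves the increment bound, as `1 + p ≥
0`. Thus `τ(max t 0) - (1 + p)t` is antitone, which also yields measurability. -/
theorem IsModeratelyVarying.antitoneOn {p : ℝ} {τ : ℝ → ℝ} (hτ : IsModeratelyVarying p τ)
    {s t : ℝ} (hst : s ≤ t) : τ (max t 0) - τ (max s 0) ≤ (1 + p) * (t - s) := by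
  have hp := hτ.nonneg
  have h1 := hτ.increment_le (max s 0) (max t 0) (le_max_right _ _) (max_le_max_right _ hst)
  refine h1.trans (mul_le_mul_of_nonneg_left ?_ (by linarith))
  rcases le_total s 0 with h2 | h2 <;> rcases le_total t 0 with h3 | h3 <;>
    simp only [h2, h3, max_eq_left, max_eq_right] <;> linarith

theorem IsModeratelyVarying.measurable {p : ℝ} {τ : ℝ → ℝ} (hτ : IsModeratelyVarying p τ) :
    Measurable fun t => τ (max t 0) := by
  have h1 : Antitone fun t => τ (max t 0) - (1 + p) * t := fun s t hst => by
    have := hτ.antitoneOn hst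
    dsimp only
    linarith
  have h2 : (fun t => τ (max t 0)) = fun t => (τ (max t 0) - (1 + p) * t) + (1 + p) * t := by
    simp only [sub_add_cancel]
  rw [h2]
  exact h1.measurable.add (measurable_id.const_mul (1 + p))

theorem IsModeratelyVarying.delayBound {h μ p : ℝ} {τ : ℝ → ℝ} (hτ : IsModeratelyVarying p τ)
    (hu : IsUncertainDelay h μ τ) : DelayBound τ h (boundFactor p * μ ^ 2) := by
  refine delayBound_of_ae_eq hτ.measurable ?_ ?_
  · filter_upwards [ae_restrict_mem measurableSet_Ici] with t ht
    rw [max_eq_left ht]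
  · intro g hg hg' w hw
    have hgμ : ∀ t, |t - g t| ≤ μ := fun t => by
      have := hu.mem_Icc (t := max (t + h) 0) (le_max_right _ _)
      rw [hg', abs_le]
      constructor <;> linarith
    have hgp : ∀ s t, s ≤ t → g s - g t ≤ p * (t - s) := fun s t hst => by
      have := hτ.antitoneOn (s := s + h) (t := t + h) (by linarith)
      rw [hg', hg']
      linarith
    unfold boundFactor
    split_ifs with hp
    · exact lintegral_sq_delay_le_of_nonneg hg hgμ hτ.nonneg hgp hw
    · exact lintegral_sq_delay_le_of_one_le hg hgμ (not_lt.1 hp) hgp hw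

theorem boundFactor_nonneg {p : ℝ} (hp : 0 ≤ p) : 0 ≤ boundFactor p := by
  unfold boundFactor
  split_ifs with h
  · positivity
  · exact div_nonneg (by linarith) (by linarith)

variable {n : ℕ}

/-- Freezing `x` to the left of `t₀ - r` gives continuity on the whole line; no delayed argument
from times `t > t₀` reaches there. -/
theorem IsSolution.isGlobalSolution {A₀ A₁ : Matrix (Fin n) (Fin n) ℝ} {τ : ℝ → ℝ} {r t₀ : ℝ}
    {x : ℝ → EuclideanSpace ℝ (Fin n)} (hx : IsSolution A₀ A₁ τ r t₀ x) (hr : 0 ≤ r)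
    (hτ : ∀ t, t₀ ≤ t → τ t ≤ r) :
    IsGlobalSolution (toEuclideanLin A₀).toContinuousLinearMap
      (toEuclideanLin A₁).toContinuousLinearMap τ t₀ (fun t => x (max t (t₀ - r))) where
  continuous := by
    refine hx.continuousOn.comp_continuous (by fun_prop) fun t => ?_
    exact le_max_right t (t₀ - r)
  absolutelyContinuous t ht := by
    refine (hx.absolutelyContinuous t ht).congr fun s hs => ?_
    rw [Set.uIcc_of_le ht] at hs
    rw [max_eq_left (by linarith [hs.1])]
  ae_hasDerivAt := by
    filter_upwards [hx.ae_hasDerivAt] with t ht htm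
    rw [max_eq_left (by linarith), max_eq_left (by linarith [hτ t htm.le])]
    refine (ht htm).congr_of_eventuallyEq ?_
    filter_upwards [lt_mem_nhds (show t₀ - r < t by linarith)] with s hs
    rw [max_eq_left hs.le]

theorem ofLp_dotProduct_self (x : EuclideanSpace ℝ (Fin n)) : x.ofLp ⬝ᵥ x.ofLp = ‖x‖ ^ 2 := by
  rw [EuclideanSpace.real_norm_sq_eq]; simp [dotProduct, sq]

open scoped MatrixOrder in
/-- A positive semidefinite matrix as a Gram operator. -/
theorem _root_.Matrix.PosSemidef.exists_clm {M : Matrix (Fin n) (Fin n) ℝ} (hM : M.PosSemidef) :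
    ∃ B : EuclideanSpace ℝ (Fin n) →L[ℝ] EuclideanSpace ℝ (Fin n),
      ∀ x y : EuclideanSpace ℝ (Fin n), inner ℝ (B x) (B y) = y.ofLp ⬝ᵥ M *ᵥ x.ofLp := by
  obtain ⟨B, rfl⟩ := CStarAlgebra.nonneg_iff_eq_star_mul_self.mp hM.nonneg
  refine ⟨(toEuclideanLin B).toContinuousLinearMap, fun x y => ?_⟩
  rw [← mulVec_mulVec, star_eq_conjTranspose, conjTranspose_eq_transpose_of_trivial,
    dotProduct_transpose_mulVec_comm]
  simp only [LinearMap.coe_toContinuousLinearMap', EuclideanSpace.inner_eq_star_dotProduct,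
    ofLp_toLpLin, toLin'_apply, star_trivial]
  exact dotProduct_comm _ _

/-- The dissipation inequality encoded by the linear matrix inequality. -/
theorem LMIFeasible.exists_dissipation [NeZero n] {A₀ A₁ : Matrix (Fin n) (Fin n) ℝ} {h μ F : ℝ}
    (hμ0 : 0 ≤ μ) (hμh : μ ≤ h) (hlmi : LMIFeasible A₀ A₁ h μ F) :
    0 < μ ∧ ∃ (V S R Rₐ : EuclideanSpace ℝ (Fin n) →L[ℝ] EuclideanSpace ℝ (Fin n)) (ε c : ℝ),
      0 < ε ∧ 0 < c ∧ (∀ x, c * ‖x‖ ^ 2 ≤ ‖V x‖ ^ 2) ∧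
      ∀ x y ζ u : EuclideanSpace ℝ (Fin n),
        y = (toEuclideanLin A₀).toContinuousLinearMap x
          + (toEuclideanLin A₁).toContinuousLinearMap (ζ - u) →
      2 * inner ℝ (V x) (V y) + ‖S x‖ ^ 2 - ‖S ζ‖ ^ 2 + h * ‖R y‖ ^ 2 - h⁻¹ * ‖R (x - ζ)‖ ^ 2
        - μ⁻¹ * ‖Rₐ u‖ ^ 2 + μ * F * ‖Rₐ y‖ ^ 2 + ε * (‖x‖ ^ 2 + ‖y‖ ^ 2) ≤ 0 := by
  obtain ⟨P₁, P₂, P₃, S, Y₁, Y₂, T, R, Rₐ, hP₁, hS, hN⟩ := hlmi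
  have hμR : (μ • Rₐ).PosDef := by
    have := hN.submatrix (e := fun i : Fin n => Sum.inr (Sum.inl i))
      (Sum.inr_injective.comp Sum.inl_injective)
    convert this using 1
    ext i j; simp [lmiMatrix, symBlocks]
  have hhR : (h • R).PosDef := by
    have := hN.submatrix (e := fun i : Fin n => Sum.inl (Sum.inr i))
      (Sum.inl_injective.comp Sum.inr_injective)
    convert this using 1
    ext i j; simp [lmiMatrix, matGamma, symBlocks]
  -- For `μ = 0` the diagonal block `-μRₐ` is zero, which is impossible in a definite matrix when `n
  -- > 0`.
  have hμ : 0 < μ := by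
    refine lt_of_le_of_ne hμ0 ?_
    rintro rfl
    have := hμR.diag_pos (i := (0 : Fin n))
    simp at this
  have hh : 0 < h := hμ.trans_le hμh
  have hR : R.PosSemidef := by
    have := (hhR.smul (inv_pos.2 hh)).posSemidef
    rwa [smul_smul, inv_mul_cancel₀ hh.ne', one_smul] at this
  have hRₐ : Rₐ.PosSemidef := by
    have := (hμR.smul (inv_pos.2 hμ)).posSemidef
    rwa [smul_smul, inv_mul_cancel₀ hμ.ne', one_smul] at this
  obtain ⟨BV, hBV⟩ := hP₁.posSemidef.exists_clm
  obtain ⟨BS, hBS⟩ := hS.posSemidef.exists_clm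
  obtain ⟨BR, hBR⟩ := hR.exists_clm
  obtain ⟨BA, hBA⟩ := hRₐ.exists_clm
  obtain ⟨ε, hε, hεN⟩ := hN.exists_le_dotProduct
  obtain ⟨c, hc, hcP⟩ := hP₁.exists_le_dotProduct
  refine ⟨hμ, BV, BS, BR, BA, ε, c, hε, hc, fun x => ?_, fun x y ζ u hy => ?_⟩
  · rw [← real_inner_self_eq_norm_sq (BV x), hBV, ← ofLp_dotProduct_self]
    exact hcP _
  simp only [← real_inner_self_eq_norm_sq (BS _), ← real_inner_self_eq_norm_sq (BR _),
    ← real_inner_self_eq_norm_sq (BA _), hBV, hBS, hBR, hBA]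
  have hy' : y.ofLp = A₀ *ᵥ x.ofLp + A₁ *ᵥ (ζ.ofLp - u.ofLp) := by
    rw [hy]
    simp [mulVec_sub]
  have h1 := lmiMatrix_form_trajectory (F := F) hh.ne' hμ.ne' P₁ P₂ P₃ S Y₁ Y₂ T R Rₐ hy'
  have h2 := hεN (Sum.elim (Sum.elim (Sum.elim (Sum.elim x.ofLp y.ofLp) ζ.ofLp)
    (-h⁻¹ • (x.ofLp - ζ.ofLp))) (Sum.elim (-μ⁻¹ • u.ofLp) y.ofLp))
  rw [neg_mulVec, dotProduct_neg, h1] at h2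
  simp only [sumElim_dotProduct_sumElim, ofLp_dotProduct_self] at h2
  have h3 : ∀ v : Fin n → ℝ, 0 ≤ v ⬝ᵥ v := fun v => by
    simpa using dotProduct_star_self_nonneg v
  have h4 : ε * (‖x‖ ^ 2 + ‖y‖ ^ 2) ≤ ε * (‖x‖ ^ 2 + ‖y‖ ^ 2 + ‖ζ‖ ^ 2 +
      (-h⁻¹ • (x.ofLp - ζ.ofLp)) ⬝ᵥ (-h⁻¹ • (x.ofLp - ζ.ofLp)) +
      ((-μ⁻¹ • u.ofLp) ⬝ᵥ (-μ⁻¹ • u.ofLp) + ‖y‖ ^ 2)) := by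
    refine mul_le_mul_of_nonneg_left ?_ hε.le
    have := h3 (-h⁻¹ • (x.ofLp - ζ.ofLp))
    have := h3 (-μ⁻¹ • u.ofLp)
    have := sq_nonneg ‖ζ‖
    have := sq_nonneg ‖y‖
    linarith
  have h5 : (x - ζ).ofLp = x.ofLp - ζ.ofLp := rfl
  rw [h5]
  linarith

theorem LMIFeasible.isAsymptoticallyStable {A₀ A₁ : Matrix (Fin n) (Fin n) ℝ} {h μ F : ℝ}
    (hlmi : LMIFeasible A₀ A₁ h μ F) (hF : 0 ≤ F) {τ : ℝ → ℝ} (hu : IsUncertainDelay h μ τ)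
    (hτm : IsFastVarying τ) (hop : DelayBound τ h (F * μ ^ 2)) :
    IsAsymptoticallyStable A₀ A₁ τ (h + μ) := by
  intro t₀ ht₀
  -- In dimension zero feasibility does not force `μ > 0`, but every solution is zero.
  rcases Nat.eq_zero_or_pos n with rfl | hn
  · refine ⟨fun ε hε => ⟨1, one_pos, fun x _ _ t _ => ?_⟩, fun x _ => ?_⟩
    · rw [Subsingleton.elim (x t) 0, norm_zero]; exact hε
    · rw [show x = fun _ => 0 from funext fun t => Subsingleton.elim _ _]
      exact tendsto_const_nhds
  have : NeZero n := ⟨hn.ne'⟩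
  have hμ0 : 0 ≤ μ := by linarith [(hu.mem_Icc le_rfl).1, (hu.mem_Icc le_rfl).2]
  obtain ⟨hμ, V, S, R, Rₐ, ε, c, hε, hc, hV, hdiss⟩ := hlmi.exists_dissipation hμ0 hu.1
  have hr : 0 ≤ h + μ := by linarith [hu.1]
  obtain ⟨K, hK0, hK⟩ := exists_bound_of_dissipation _ _ hμ hu.1 hF hε hc ht₀ hτm
    (fun t ht => hu.mem_Icc ht) hV hdiss hop
  have hglob : ∀ x, IsSolution A₀ A₁ τ (h + μ) t₀ x → _ := fun x hx =>
    hx.isGlobalSolution hr fun t ht => (hu.mem_Icc (ht₀.trans ht)).2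
  have hmax : ∀ s, t₀ - (h + μ) ≤ s → max s (t₀ - (h + μ)) = s := fun s hs => max_eq_left hs
  constructor
  · intro e he
    -- `K + 1` avoids division by zero and makes the final inequality strict.
    refine ⟨e / (K + 1), by positivity, fun x hx hxδ t ht => ?_⟩
    have h1 := (hK _ (e / (K + 1)) (hglob x hx) (fun s hs => by
      rw [hmax s hs.1]; exact (hxδ s hs).le)).1 t ht
    rw [hmax t (by linarith)] at h1
    refine h1.trans_lt ?_
    rw [mul_div_assoc', div_lt_iff₀ (by positivity)]
    linarith
  · intro x hx
    obtain ⟨D, hD⟩ := (isCompact_Icc (a := t₀ - (h + μ)) (b := t₀)).exists_bound_of_continuousOn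
      (hx.continuousOn.mono Set.Icc_subset_Ici_self)
    refine ((hK _ D (hglob x hx) (fun s hs => by rw [hmax s hs.1]; exact hD s hs)).2).congr' ?_
    filter_upwards [eventually_ge_atTop (t₀ - (h + μ))] with t ht
    rw [hmax t ht]

end DelayLMI

end

theorem theorem2 (n : ℕ) (A₀ A₁ : Matrix (Fin n) (Fin n) ℝ) (h μ : ℝ) :
    (∀ p : ℝ, 0 ≤ p → DelayLMI.LMIFeasible A₀ A₁ h μ (DelayLMI.boundFactor p) →
      ∀ τ : ℝ → ℝ, DelayLMI.IsUncertainDelay h μ τ → DelayLMI.IsModeratelyVarying p τ →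
        DelayLMI.IsAsymptoticallyStable A₀ A₁ τ (h + μ)) ∧
    (DelayLMI.LMIFeasible A₀ A₁ h μ DelayLMI.boundFactorTop →
      ∀ τ : ℝ → ℝ, DelayLMI.IsUncertainDelay h μ τ → DelayLMI.IsFastVarying τ →
        DelayLMI.IsAsymptoticallyStable A₀ A₁ τ (h + μ)) := by
  constructor
  · intro p hp hlmi τ hu hτ
    refine hlmi.isAsymptoticallyStable (DelayLMI.boundFactor_nonneg hp) hu ?_ (hτ.delayBound hu)
    refine hτ.measurable.aemeasurable.congr ?_
    filter_upwards [ae_restrict_mem measurableSet_Ici] with t ht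
    rw [max_eq_left ht]
  · intro hlmi τ hu hτ
    refine hlmi.isAsymptoticallyStable ?_ hu hτ (hτ.delayBound hu)
    norm_num [DelayLMI.boundFactorTop]
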